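/- Let $d\ge 1$, let $G$ be a finite group, let $X$ be a finite (left) $G$-set and let $k$ be a field. Let $\mathrm{cob}(d)$ be the symmetric monoidal category whose objects are closed oriented smooth $(d-1)$-manifolds and whose morphisms $\Sigma_1\to\Sigma_2$ are diffeomorphism classes, relative to the boundary, of compact oriented smooth $d$-manifolds $M$ with an identification $\partial M\cong\Sigma_1\sqcup\overline{\Sigma_2}$; composition is gluing, identities are cylinders, and the monoidal product is disjoint union. Let $G\mathrm{cob}(d)$ be the symmetric monoidal category whose objects are principal $G$-bundles $P\to\Sigma$ over closed oriented smooth $(d-1)$-manifolds, with a marked point on every connected component of $P$, and whose morphisms from $P\to\Sigma_1$ to $Q\to\Sigma_2$ are diffeomorphism classes of principal $G$-bundles $E\to M$ over cobordisms $M:\Sigma_1\to\Sigma_2$ together with identifications of the restrictions of $E$ to the two parts of $\partial M$ with $P$ and $Q$ (diffeomorphisms being covered by $G$-equivariant bundle isomorphisms that are compatible with these identifications); composition is gluing of bundles over glued cobordisms, identities are cylinders, and the monoidal product is disjoint union. A $d$-dimensional TFT is a symmetric monoidal functor $\mathrm{cob}(d)\to\mathrm{Vect}_k$, and a $d$-dimensional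 $G$-equivariant TFT is a symmetric monoidal functor $G\mathrm{cob}(d)\to\mathrm{Vect}_k$. For a principal $G$-bundle $P\to M$ let $X\times_G P=(X\times P)/\big((g^{-1}x,p)\sim(x,gp)\big)$ be the associated covering of $M$, with the smooth structure and the orientation pulled back from $M$. Then the assignments $(P\to\Sigma)\mapsto X\times_G P$ on objects, $(E\to M)\mapsto X\times_G E$ on cobordisms, and correspondingly on diffeomorphisms, with the evident diffeomorphisms $(X\times_G P)\sqcup(X\times_G Q)\cong X\times_G(P\sqcup Q)$ and $\emptyset\cong X\times_G\emptyset$ as structure isomorphisms, define a symmetric monoidal functor $\mathcal F_X:G\mathrm{cob}(d)\to\mathrm{cob}(d)$; and for every $d$-dimensional TFT $Z:\mathrm{cob}(d)\to\mathrm{Vect}_k$ the composite $Z\circ\mathcal F_X$, with the composite monoidal structure, is a $d$-dimensional $G$-equivariant TFT. -/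

import Mathlib

open scoped Manifold ContDiff Topology
open CategoryTheory Topology

universe u v w

set_option linter.unusedSectionVars false
set_option linter.checkUnivs false

namespace TFT

/-! ### Symmetric monoidal categories of cobordisms -/

/-- Generators and relations for a symmetric monoidal category of cobordisms: objects with a
disjoint union, invertible generators (diffeomorphisms of objects), and cobordisms, together with
the geometric relations between them.

A composite of two cobordisms is a smooth manifold only after a choice of collars, and is unique
only up to diffeomorphism.  So the category is built from the relation "`N` is a gluing of `M`
and `M'`".  Since gluings exist, are unique up to diffeomorphism relative to the boundary, and are
compatible with diffeomorphisms and disjoint unions, every morphism of the resulting category is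
the class of a single cobordism, two cobordisms with the same ends give the same morphism exactly
when they are diffeomorphic relative to their ends, and a diffeomorphism is identified with its
mapping cylinder: this is the usual category of cobordisms. -/
structure CobordismData where
  Obj : Type v
  unit : Obj
  sum : Obj → Obj → Obj
  Iso : Obj → Obj → Type w
  refl : ∀ A, Iso A A
  symm : ∀ {A B}, Iso A B → Iso B A
  trans : ∀ {A B C}, Iso A B → Iso B C → Iso A C
  sumIso : ∀ {A B C D}, Iso A B → Iso C D → Iso (sum A C) (sum B D)
  sumAssoc : ∀ A B C, Iso (sum (sum A B) C) (sum A (sum B C))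
  emptySum : ∀ A, Iso (sum unit A) A
  sumEmpty : ∀ A, Iso (sum A unit) A
  sumComm : ∀ A B, Iso (sum A B) (sum B A)
  Bord : Obj → Obj → Type v
  sumBord : ∀ {A B C D}, Bord A B → Bord C D → Bord (sum A C) (sum B D)
  /-- `IsGluing M M' N`: the cobordism `N` is obtained by gluing `M` and `M'` along their common
  boundary part. -/
  IsGluing : ∀ {A B C}, Bord A B → Bord B C → Bord A C → Prop
  /-- `IsCylinder φ M`: the cobordism `M` is the cylinder `A × [0, 1]`, whose end is identified
  with the target by `φ`. -/
  IsCylinder : ∀ {A B}, Iso A B → Bord A B → Prop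
  /-- `IsDiffeo φ ψ M N`: there is a diffeomorphism `M ≅ N` that restricts to `φ` on the incoming
  boundary and to `ψ` on the outgoing boundary. -/
  IsDiffeo : ∀ {A A' B B'}, Iso A A' → Iso B B' → Bord A B → Bord A' B' → Prop

namespace CobordismData

variable (D : CobordismData.{v, w})

/-- Formal composites and disjoint unions of cobordisms and diffeomorphisms. -/
inductive Word : D.Obj → D.Obj → Type (max v w)
  | iso {A B : D.Obj} (φ : D.Iso A B) : Word A B
  | bord {A B : D.Obj} (M : D.Bord A B) : Word A B
  | comp {A B C : D.Obj} (f : Word A B) (g : Word B C) : Word A C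
  | sum {A B C E : D.Obj} (f : Word A B) (g : Word C E) : Word (D.sum A C) (D.sum B E)

/-- The relations between formal composites.  The first group is geometric, the second one says
that the quotient is a symmetric monoidal category whose structure isomorphisms are the evident
diffeomorphisms between disjoint unions. -/
inductive Rel : ∀ {A B : D.Obj}, D.Word A B → D.Word A B → Prop
  | glue {A B C} {M : D.Bord A B} {M' : D.Bord B C} {N : D.Bord A C} (h : D.IsGluing M M' N) :
      Rel (.comp (.bord M) (.bord M')) (.bord N)
  | cylinder {A B} {φ : D.Iso A B} {M : D.Bord A B} (h : D.IsCylinder φ M) :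
      Rel (.bord M) (.iso φ)
  | diffeo {A A' B B'} {φ : D.Iso A A'} {ψ : D.Iso B B'} {M : D.Bord A B} {N : D.Bord A' B'}
      (h : D.IsDiffeo φ ψ M N) :
      Rel (.comp (.bord M) (.iso ψ)) (.comp (.iso φ) (.bord N))
  | sum_bord {A B C E} (M : D.Bord A B) (N : D.Bord C E) :
      Rel (.sum (.bord M) (.bord N)) (.bord (D.sumBord M N))
  | sum_iso {A B C E} (φ : D.Iso A B) (ψ : D.Iso C E) :
      Rel (.sum (.iso φ) (.iso ψ)) (.iso (D.sumIso φ ψ))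
  | comp_iso {A B C} (φ : D.Iso A B) (ψ : D.Iso B C) :
      Rel (.comp (.iso φ) (.iso ψ)) (.iso (D.trans φ ψ))
  | iso_symm {A B} (φ : D.Iso A B) :
      Rel (.comp (.iso φ) (.iso (D.symm φ))) (.iso (D.refl A))
  | symm_iso {A B} (φ : D.Iso A B) :
      Rel (.comp (.iso (D.symm φ)) (.iso φ)) (.iso (D.refl B))
  | refl {A B} (f : D.Word A B) : Rel f f
  | symm {A B} {f g : D.Word A B} : Rel f g → Rel g f
  | trans {A B} {f g h : D.Word A B} : Rel f g → Rel g h → Rel f h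
  | congr_comp {A B C} {f f' : D.Word A B} {g g' : D.Word B C} :
      Rel f f' → Rel g g' → Rel (.comp f g) (.comp f' g')
  | congr_sum {A B C E} {f f' : D.Word A B} {g g' : D.Word C E} :
      Rel f f' → Rel g g' → Rel (.sum f g) (.sum f' g')
  | id_comp {A B} (f : D.Word A B) : Rel (.comp (.iso (D.refl A)) f) f
  | comp_id {A B} (f : D.Word A B) : Rel (.comp f (.iso (D.refl B))) f
  | assoc {A B C E} (f : D.Word A B) (g : D.Word B C) (h : D.Word C E) :
      Rel (.comp (.comp f g) h) (.comp f (.comp g h))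
  | sum_id (A B) :
      Rel (.sum (.iso (D.refl A)) (.iso (D.refl B))) (.iso (D.refl (D.sum A B)))
  | sum_comp {A B C A' B' C'} (f : D.Word A B) (g : D.Word B C) (f' : D.Word A' B')
      (g' : D.Word B' C') :
      Rel (.sum (.comp f g) (.comp f' g')) (.comp (.sum f f') (.sum g g'))
  | assoc_naturality {A B C A' B' C'} (f : D.Word A A') (g : D.Word B B') (h : D.Word C C') :
      Rel (.comp (.sum (.sum f g) h) (.iso (D.sumAssoc A' B' C')))
        (.comp (.iso (D.sumAssoc A B C)) (.sum f (.sum g h)))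
  | left_naturality {A B} (f : D.Word A B) :
      Rel (.comp (.sum (.iso (D.refl D.unit)) f) (.iso (D.emptySum B)))
        (.comp (.iso (D.emptySum A)) f)
  | right_naturality {A B} (f : D.Word A B) :
      Rel (.comp (.sum f (.iso (D.refl D.unit))) (.iso (D.sumEmpty B)))
        (.comp (.iso (D.sumEmpty A)) f)
  | comm_naturality {A B A' B'} (f : D.Word A A') (g : D.Word B B') :
      Rel (.comp (.sum f g) (.iso (D.sumComm A' B'))) (.comp (.iso (D.sumComm A B)) (.sum g f))
  | pentagon (A B C E) :
      Rel (.comp (.sum (.iso (D.sumAssoc A B C)) (.iso (D.refl E)))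
          (.comp (.iso (D.sumAssoc A (D.sum B C) E))
            (.sum (.iso (D.refl A)) (.iso (D.sumAssoc B C E)))))
        (.comp (.iso (D.sumAssoc (D.sum A B) C E)) (.iso (D.sumAssoc A B (D.sum C E))))
  | triangle (A B) :
      Rel (.comp (.iso (D.sumAssoc A D.unit B)) (.sum (.iso (D.refl A)) (.iso (D.emptySum B))))
        (.sum (.iso (D.sumEmpty A)) (.iso (D.refl B)))
  | hexagon (A B C) :
      Rel (.comp (.iso (D.sumAssoc A B C))
          (.comp (.iso (D.sumComm A (D.sum B C))) (.iso (D.sumAssoc B C A))))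
        (.comp (.sum (.iso (D.sumComm A B)) (.iso (D.refl C)))
          (.comp (.iso (D.sumAssoc B A C)) (.sum (.iso (D.refl B)) (.iso (D.sumComm A C)))))
  | hexagon_reverse (A B C) :
      Rel (.comp (.iso (D.symm (D.sumAssoc A B C)))
          (.comp (.iso (D.sumComm (D.sum A B) C)) (.iso (D.symm (D.sumAssoc C A B)))))
        (.comp (.sum (.iso (D.refl A)) (.iso (D.sumComm B C)))
          (.comp (.iso (D.symm (D.sumAssoc A C B))) (.sum (.iso (D.sumComm A C)) (.iso (D.refl B)))))
  | comm_comm (A B) :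
      Rel (.comp (.iso (D.sumComm A B)) (.iso (D.sumComm B A))) (.iso (D.refl (D.sum A B)))

/-- Equality of formal composites modulo the relations. -/
def wordSetoid (A B : D.Obj) : Setoid (D.Word A B) where
  r := D.Rel
  iseqv := ⟨.refl, .symm, .trans⟩

/-- The category presented by `D`. -/
structure Cat where
  obj : D.Obj

variable {D}

theorem sound {A B : D.Obj} {f g : D.Word A B} (h : D.Rel f g) :
    Quotient.mk (D.wordSetoid A B) f = Quotient.mk _ g :=
  Quotient.sound h

instance : Category D.Cat where
  Hom A B := Quotient (D.wordSetoid A.obj B.obj)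
  id A := Quotient.mk _ (.iso (D.refl A.obj))
  comp := Quotient.map₂ .comp fun _ _ h _ _ h' => .congr_comp h h'
  id_comp := by rintro _ _ ⟨f⟩; exact sound (.id_comp f)
  comp_id := by rintro _ _ ⟨f⟩; exact sound (.comp_id f)
  assoc := by rintro _ _ _ _ ⟨f⟩ ⟨g⟩ ⟨h⟩; exact sound (.assoc f g h)

/-- The morphism represented by a formal composite. -/
def homMk {A B : D.Obj} (f : D.Word A B) : Cat.mk A ⟶ Cat.mk B := Quotient.mk _ f

/-- The morphism given by a cobordism. -/
def bordHom {A B : D.Obj} (M : D.Bord A B) : Cat.mk A ⟶ Cat.mk B := homMk (.bord M)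

/-- The isomorphism given by a diffeomorphism. -/
@[simps]
def isoHom {A B : D.Obj} (φ : D.Iso A B) : Cat.mk A ≅ Cat.mk B where
  hom := homMk (.iso φ)
  inv := homMk (.iso (D.symm φ))
  hom_inv_id := sound (.iso_symm φ)
  inv_hom_id := sound (.symm_iso φ)

/-- Disjoint union of morphisms. -/
def tensorHom {A B C E : D.Cat} (f : A ⟶ B) (g : C ⟶ E) :
    Cat.mk (D.sum A.obj C.obj) ⟶ Cat.mk (D.sum B.obj E.obj) :=
  Quotient.map₂ .sum (fun _ _ h _ _ h' => .congr_sum h h') f g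

instance : MonoidalCategoryStruct D.Cat where
  tensorObj A B := ⟨D.sum A.obj B.obj⟩
  tensorHom f g := tensorHom f g
  whiskerLeft A _ _ f := tensorHom (𝟙 A) f
  whiskerRight f A := tensorHom f (𝟙 A)
  tensorUnit := ⟨D.unit⟩
  associator A B C := isoHom (D.sumAssoc A.obj B.obj C.obj)
  leftUnitor A := isoHom (D.emptySum A.obj)
  rightUnitor A := isoHom (D.sumEmpty A.obj)

instance : MonoidalCategory D.Cat :=
  .ofTensorHom
    (id_tensorHom_id := fun A B => sound (.sum_id A.obj B.obj))
    (id_tensorHom := fun _ _ _ _ => rfl)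
    (tensorHom_id := fun _ _ => rfl)
    (tensorHom_comp_tensorHom := by
      rintro _ _ _ _ _ _ ⟨f⟩ ⟨g⟩ ⟨f'⟩ ⟨g'⟩; exact sound (.symm (.sum_comp f f' g g')))
    (associator_naturality := by
      rintro _ _ _ _ _ _ ⟨f⟩ ⟨g⟩ ⟨h⟩; exact sound (.assoc_naturality f g h))
    (leftUnitor_naturality := by rintro _ _ ⟨f⟩; exact sound (.left_naturality f))
    (rightUnitor_naturality := by rintro _ _ ⟨f⟩; exact sound (.right_naturality f))
    (pentagon := fun A B C E => sound (.pentagon A.obj B.obj C.obj E.obj))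
    (triangle := fun A B => sound (.triangle A.obj B.obj))

instance : SymmetricCategory D.Cat where
  braiding A B := isoHom (D.sumComm A.obj B.obj)
  braiding_naturality_right := by
    rintro A _ _ ⟨f⟩; exact sound (.comm_naturality (.iso (D.refl A.obj)) f)
  braiding_naturality_left := by
    rintro _ _ ⟨f⟩ C; exact sound (.comm_naturality f (.iso (D.refl C.obj)))
  hexagon_forward A B C := sound (.hexagon A.obj B.obj C.obj)
  hexagon_reverse A B C := sound (.hexagon_reverse A.obj B.obj C.obj)
  symmetry A B := sound (.comm_comm A.obj B.obj)

end CobordismData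
/-! ### Oriented manifolds -/

/-- The linear map `A` is an isomorphism that maps the orientation `o` to `o'`. -/
def MapsOrientation {d : ℕ} (A : EuclideanSpace ℝ (Fin d) →L[ℝ] EuclideanSpace ℝ (Fin d))
    (o o' : Orientation ℝ (EuclideanSpace ℝ (Fin d)) (Fin d)) : Prop :=
  ∃ e : EuclideanSpace ℝ (Fin d) ≃ₗ[ℝ] EuclideanSpace ℝ (Fin d),
    (∀ v, e v = A v) ∧ Orientation.map (Fin d) e o = o'

theorem MapsOrientation.id {d : ℕ} (o : Orientation ℝ (EuclideanSpace ℝ (Fin d)) (Fin d)) :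
    MapsOrientation (ContinuousLinearMap.id ℝ _) o o :=
  ⟨LinearEquiv.refl ℝ _, fun _ => rfl, by simp⟩

theorem MapsOrientation.comp {d : ℕ}
    {A B : EuclideanSpace ℝ (Fin d) →L[ℝ] EuclideanSpace ℝ (Fin d)}
    {o o' o'' : Orientation ℝ (EuclideanSpace ℝ (Fin d)) (Fin d)}
    (hB : MapsOrientation B o' o'') (hA : MapsOrientation A o o') :
    MapsOrientation (B.comp A) o o'' := by
  obtain ⟨e, he, rfl⟩ := hA
  obtain ⟨f, hf, rfl⟩ := hB
  refine ⟨e.trans f, fun v => by simp [he, hf], ?_⟩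
  induction o using Module.Ray.ind with
  | h x hx => rfl

theorem MapsOrientation.of_comp {d : ℕ}
    {A B : EuclideanSpace ℝ (Fin d) →L[ℝ] EuclideanSpace ℝ (Fin d)}
    {o o' : Orientation ℝ (EuclideanSpace ℝ (Fin d)) (Fin d)}
    (hA : MapsOrientation A o o') (h : B.comp A = ContinuousLinearMap.id ℝ _) :
    MapsOrientation B o' o := by
  obtain ⟨e, he, rfl⟩ := hA
  refine ⟨e.symm, fun v => ?_, ?_⟩
  · obtain ⟨w, rfl⟩ := e.surjective v
    have := congrArg (fun T => T w) h
    simp only [ContinuousLinearMap.comp_apply, ContinuousLinearMap.id_apply] at this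
    rw [he, this, ← he, e.symm_apply_apply]
  · rw [← Orientation.map_symm, Equiv.symm_apply_apply]

section Manifold

variable {d : ℕ} {H : Type*} [TopologicalSpace H] (I : ModelWithCorners ℝ (EuclideanSpace ℝ (Fin d)) H)

/-- An orientation of a `d`-dimensional manifold: an orientation of each tangent space, locally
constant in charts.  The tangent space at `x` is `EuclideanSpace ℝ (Fin d)`, identified by means
of the preferred chart at `x`. -/
def IsOrientation (M : Type*) [TopologicalSpace M] [ChartedSpace H M] [IsManifold I ∞ M]
    (o : M → Orientation ℝ (EuclideanSpace ℝ (Fin d)) (Fin d)) : Prop :=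
  ∀ x₀ : M, ∀ᶠ x in 𝓝 x₀, MapsOrientation (tangentCoordChange I x x₀ x) (o x) (o x₀)

/-- The derivative of `f` at `x`, in the preferred charts at `x` and `f x`. -/
noncomputable def tderiv {d' : ℕ} {H' : Type*} [TopologicalSpace H']
    (J : ModelWithCorners ℝ (EuclideanSpace ℝ (Fin d')) H')
    {M N : Type*} [TopologicalSpace M] [ChartedSpace H M] [TopologicalSpace N] [ChartedSpace H' N]
    (f : M → N) (x : M) : EuclideanSpace ℝ (Fin d) →L[ℝ] EuclideanSpace ℝ (Fin d') :=
  mfderiv I J f x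

variable {M N M' N' P : Type*} [TopologicalSpace M] [ChartedSpace H M]
  [TopologicalSpace N] [ChartedSpace H N] [TopologicalSpace P] [ChartedSpace H P]
  [TopologicalSpace M'] [ChartedSpace H M']

/-- The map `f` is smooth, with invertible and orientation preserving derivative everywhere. -/
structure IsOrientedMap (o : M → Orientation ℝ (EuclideanSpace ℝ (Fin d)) (Fin d))
    (o' : N → Orientation ℝ (EuclideanSpace ℝ (Fin d)) (Fin d)) (f : M → N) : Prop where
  smooth : ContMDiff I I ∞ f
  orient : ∀ x, MapsOrientation (tderiv I I f x) (o x) (o' (f x))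

variable {o : M → Orientation ℝ (EuclideanSpace ℝ (Fin d)) (Fin d)}
  {o' : N → Orientation ℝ (EuclideanSpace ℝ (Fin d)) (Fin d)}
  {o'' : P → Orientation ℝ (EuclideanSpace ℝ (Fin d)) (Fin d)}
  {oM' : M' → Orientation ℝ (EuclideanSpace ℝ (Fin d)) (Fin d)}

theorem IsOrientedMap.id : IsOrientedMap I o o (id : M → M) where
  smooth := contMDiff_id
  orient x := by
    have : tderiv I I (_root_.id : M → M) x = ContinuousLinearMap.id ℝ _ := mfderiv_id
    rw [this]; exact .id _

variable {I}

theorem tderiv_comp {d' d'' : ℕ} {H' H'' : Type*} [TopologicalSpace H'] [TopologicalSpace H'']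
    {J : ModelWithCorners ℝ (EuclideanSpace ℝ (Fin d')) H'}
    {K : ModelWithCorners ℝ (EuclideanSpace ℝ (Fin d'')) H''}
    {N P : Type*} [TopologicalSpace N] [ChartedSpace H' N] [TopologicalSpace P] [ChartedSpace H'' P]
    {g : N → P} {f : M → N}
    (hg : ContMDiff J K ∞ g) (hf : ContMDiff I J ∞ f) (x : M) :
    tderiv I K (g ∘ f) x = (tderiv J K g (f x)).comp (tderiv I J f x) :=
  mfderiv_comp x (hg.mdifferentiable (by simp) _) (hf.mdifferentiable (by simp) _)

theorem IsOrientedMap.comp {g : N → P} {f : M → N} (hg : IsOrientedMap I o' o'' g)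
    (hf : IsOrientedMap I o o' f) : IsOrientedMap I o o'' (g ∘ f) where
  smooth := hg.smooth.comp hf.smooth
  orient x := by
    rw [tderiv_comp hg.smooth hf.smooth]
    exact (hg.orient _).comp (hf.orient x)

theorem IsOrientedMap.inverse {f : M → N} {g : N → M} (hf : IsOrientedMap I o o' f)
    (hg : ContMDiff I I ∞ g) (h : Function.LeftInverse g f) (h' : Function.RightInverse g f) :
    IsOrientedMap I o' o g where
  smooth := hg
  orient y := by
    obtain ⟨x, rfl⟩ := h'.surjective y
    rw [h x]
    refine (hf.orient x).of_comp ?_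
    rw [← tderiv_comp hg hf.smooth, h.comp_eq_id]
    exact mfderiv_id

theorem tderiv_inl (x : M) :
    tderiv I I (Sum.inl : M → M ⊕ N) x = ContinuousLinearMap.id ℝ _ := by
  exact mfderiv_sumInl (I := I) (M := M) (M' := N) (q := x) (p := Sum.inl x)

theorem tderiv_inr (x : N) :
    tderiv I I (Sum.inr : N → M ⊕ N) x = ContinuousLinearMap.id ℝ _ := by
  exact mfderiv_sumInr (I := I) (M := M) (M' := N) (q' := x)

theorem IsOrientedMap.inl : IsOrientedMap I o (Sum.elim o o') (Sum.inl : M → M ⊕ N) where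
  smooth := .inl
  orient x := by rw [tderiv_inl]; exact .id _

theorem IsOrientedMap.inr : IsOrientedMap I o' (Sum.elim o o') (Sum.inr : N → M ⊕ N) where
  smooth := .inr
  orient x := by rw [tderiv_inr]; exact .id _

theorem IsOrientedMap.of_sum {f : M ⊕ N → P} (hl : IsOrientedMap I o o'' (f ∘ Sum.inl))
    (hr : IsOrientedMap I o' o'' (f ∘ Sum.inr)) : IsOrientedMap I (Sum.elim o o') o'' f := by
  have hf : ContMDiff I I ∞ f := by
    rw [← Sum.elim_comp_inl_inr f]; exact hl.smooth.sumElim hr.smooth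
  refine ⟨hf, ?_⟩
  rintro (x | x)
  · have h := hl.orient x
    rwa [tderiv_comp hf .inl, tderiv_inl, ContinuousLinearMap.comp_id] at h
  · have h := hr.orient x
    rwa [tderiv_comp hf .inr, tderiv_inr, ContinuousLinearMap.comp_id] at h

theorem tangentCoordChange_inl [IsManifold I ∞ M] [IsManifold I ∞ N] (x y : M) :
    tangentCoordChange I (Sum.inl x : M ⊕ N) (Sum.inl y) (Sum.inl x) =
      tangentCoordChange I x y x := by
  rw [tangentCoordChange_def, tangentCoordChange_def, extChartAt_inl_apply]
  congr 1
  ext v : 1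
  simp [extChartAt, ChartedSpace.sum_chartAt_inl, Sum.inl_injective.extend_apply]

theorem tangentCoordChange_inr [IsManifold I ∞ M] [IsManifold I ∞ N] (x y : N) :
    tangentCoordChange I (Sum.inr x : M ⊕ N) (Sum.inr y) (Sum.inr x) =
      tangentCoordChange I x y x := by
  rw [tangentCoordChange_def, tangentCoordChange_def, extChartAt_inr_apply]
  congr 1
  ext v : 1
  simp [extChartAt, ChartedSpace.sum_chartAt_inr, Sum.inr_injective.extend_apply]

theorem IsOrientation.sum [IsManifold I ∞ M] [IsManifold I ∞ N] (h : IsOrientation I M o)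
    (h' : IsOrientation I N o') : IsOrientation I (M ⊕ N) (Sum.elim o o') := by
  rintro (x | x)
  · rw [nhds_inl, Filter.eventually_map]
    filter_upwards [h x] with y hy
    rw [tangentCoordChange_inl]; exact hy
  · rw [nhds_inr, Filter.eventually_map]
    filter_upwards [h' x] with y hy
    rw [tangentCoordChange_inr]; exact hy

/-! ### Manifold structure on a space with a local homeomorphism to a manifold -/

section Pullback

variable {X Y : Type*} [TopologicalSpace X] [TopologicalSpace Y]

/-- A local inverse of `f` near `x`. -/
noncomputable def loc {f : X → M} (hf : IsLocalHomeomorph f) (x : X) : OpenPartialHomeomorph X M :=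
  (hf x).choose

theorem loc_coe {f : X → M} (hf : IsLocalHomeomorph f) (x : X) : ⇑(loc hf x) = f :=
  (hf x).choose_spec.2.symm

theorem mem_loc {f : X → M} (hf : IsLocalHomeomorph f) (x : X) : x ∈ (loc hf x).source :=
  (hf x).choose_spec.1

/-- The charted space structure for which the local homeomorphism `f` is locally the identity in
charts. -/
@[reducible] noncomputable def pullbackChartedSpace {f : X → M} (hf : IsLocalHomeomorph f) :
    ChartedSpace H X where
  atlas := Set.range fun x => (loc hf x).trans (chartAt H (f x))
  chartAt x := (loc hf x).trans (chartAt H (f x))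
  mem_chart_source x := by
    rw [OpenPartialHomeomorph.trans_source]
    refine ⟨mem_loc hf x, ?_⟩
    rw [Set.mem_preimage, loc_coe]
    exact mem_chart_source H (f x)
  chart_mem_atlas x := ⟨x, rfl⟩

variable {f : X → M} (hf : IsLocalHomeomorph f)

theorem apply_symm {x : X} {p : M} (hp : p ∈ (loc hf x).target) :
    f ((loc hf x).symm p) = p := by
  have := (loc hf x).right_inv hp
  rwa [loc_coe] at this

theorem pullback_extChartAt (x y : X) :
    letI := pullbackChartedSpace (H := H) hf
    extChartAt I x y = extChartAt I (f x) (f y) := by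
  let _ := pullbackChartedSpace (H := H) hf
  change I (chartAt H (f x) ((loc hf x) y)) = I (chartAt H (f x) (f y))
  rw [loc_coe]

theorem pullback_extChartAt_symm (x : X) :
    letI := pullbackChartedSpace (H := H) hf
    ∀ᶠ v in 𝓝[Set.range I] (extChartAt I (f x) (f x)),
      f ((extChartAt I x).symm v) = (extChartAt I (f x)).symm v := by
  let _ := pullbackChartedSpace (H := H) hf
  have hx : f x ∈ (loc hf x).target := by
    have := (loc hf x).map_source (mem_loc hf x)
    rwa [loc_coe] at this
  have hc : ContinuousAt (extChartAt I (f x)).symm (extChartAt I (f x) (f x)) :=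
    continuousAt_extChartAt_symm (f x)
  have := hc.eventually_mem ((loc hf x).open_target.mem_nhds (by rwa [extChartAt_to_inv]))
  filter_upwards [this.filter_mono nhdsWithin_le_nhds] with v hv
  exact apply_symm hf hv

theorem pullback_coord (x y : X) :
    letI := pullbackChartedSpace (H := H) hf
    (extChartAt I y ∘ (extChartAt I x).symm) =ᶠ[𝓝[Set.range I] (extChartAt I (f x) (f x))]
      (extChartAt I (f y) ∘ (extChartAt I (f x)).symm) := by
  let _ := pullbackChartedSpace (H := H) hf
  filter_upwards [pullback_extChartAt_symm (I := I) hf x] with v hv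
  simp only [Function.comp_apply, pullback_extChartAt, hv]

theorem pullback_isManifold [IsManifold I ∞ M] :
    letI := pullbackChartedSpace (H := H) hf
    IsManifold I ∞ X := by
  let _ := pullbackChartedSpace (H := H) hf
  refine isManifold_of_contDiffOn I ∞ X ?_
  rintro _ _ ⟨x, rfl⟩ ⟨y, rfl⟩
  have h := ((mem_groupoid_of_pregroupoid (PG := contDiffPregroupoid ∞ I)).1
    (HasGroupoid.compatible (G := contDiffGroupoid ∞ I) (chart_mem_atlas H (f x))
      (chart_mem_atlas H (f y)))).1
  change ContDiffOn _ _ _ _ at h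
  refine (h.congr_mono ?_ ?_)
  · rintro v ⟨hv, -⟩
    have hv' : (chartAt H (f x)).symm (I.symm v) ∈ (loc hf x).target := by
      have := hv.1
      simp only [OpenPartialHomeomorph.trans_symm_eq_symm_trans_symm] at this
      exact this.2
    change I (chartAt H (f y) ((loc hf y) ((loc hf x).symm _))) = I (chartAt H (f y) _)
    rw [loc_coe]
    exact congrArg (fun z => I (chartAt H (f y) z)) (apply_symm hf hv')
  · rintro v ⟨hv, hv2⟩
    refine ⟨?_, hv2⟩
    have hv' : (chartAt H (f x)).symm (I.symm v) ∈ (loc hf x).target := by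
      have := hv.1
      simp only [OpenPartialHomeomorph.trans_symm_eq_symm_trans_symm] at this
      exact this.2
    have h1 := hv.1
    have h2 := hv.2
    simp only [OpenPartialHomeomorph.trans_symm_eq_symm_trans_symm] at h1
    refine ⟨h1.1, ?_⟩
    have h3 : (loc hf y) ((loc hf x).symm ((chartAt H (f x)).symm (I.symm v))) ∈
      (chartAt H (f y)).source := h2.2
    rw [loc_coe, apply_symm hf hv'] at h3
    exact h3

/-- A continuous map covering a smooth map is smooth, with the same derivative. -/
theorem pullback_lift {d' : ℕ} {H' : Type*} [TopologicalSpace H']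
    {J : ModelWithCorners ℝ (EuclideanSpace ℝ (Fin d')) H'} {N : Type*} [TopologicalSpace N]
    [ChartedSpace H' N] {g : Y → N} (hg : IsLocalHomeomorph g) {h : X → Y} {i : M → N}
    (hh : Continuous h) (hi : ContMDiff I J ∞ i) (hc : ∀ x, g (h x) = i (f x)) :
    letI := pullbackChartedSpace (H := H) hf
    letI := pullbackChartedSpace (H := H') hg
    ContMDiff I J ∞ h ∧ ∀ x, tderiv I J h x = tderiv I J i (f x) := by
  let _ := pullbackChartedSpace (H := H) hf
  let _ := pullbackChartedSpace (H := H') hg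
  have key : ∀ x, (extChartAt J (h x) ∘ h ∘ (extChartAt I x).symm)
      =ᶠ[𝓝[Set.range I] (extChartAt I (f x) (f x))]
      (extChartAt J (i (f x)) ∘ i ∘ (extChartAt I (f x)).symm) := by
    intro x
    filter_upwards [pullback_extChartAt_symm (I := I) hf x] with v hv
    simp only [Function.comp_apply, pullback_extChartAt, hc, hv]
  have hx : ∀ x, f ((extChartAt I x).symm (extChartAt I x x)) = f x := fun x => by
    rw [extChartAt_to_inv]
  have key0 : ∀ x, (extChartAt J (h x) ∘ h ∘ (extChartAt I x).symm) (extChartAt I (f x) (f x)) =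
      (extChartAt J (i (f x)) ∘ i ∘ (extChartAt I (f x)).symm) (extChartAt I (f x) (f x)) := by
    intro x
    have := hx x
    rw [pullback_extChartAt] at this
    simp only [Function.comp_apply, pullback_extChartAt, hc, this, extChartAt_to_inv]
  have hs : ContMDiff I J ∞ h := by
    intro x
    rw [contMDiffAt_iff]
    refine ⟨hh.continuousAt, ?_⟩
    have := (contMDiffAt_iff.1 (hi (f x))).2
    rw [pullback_extChartAt]
    exact this.congr_of_eventuallyEq (key x) (key0 x)
  refine ⟨hs, fun x => ?_⟩
  have h1 : MDifferentiableAt I J h x := hs.mdifferentiable (by simp) x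
  have h2 : MDifferentiableAt I J i (f x) := hi.mdifferentiable (by simp) _
  unfold tderiv
  rw [h1.mfderiv, h2.mfderiv]
  unfold writtenInExtChartAt
  rw [pullback_extChartAt]
  exact (key x).fderivWithin_eq (key0 x)

theorem pullback_isOrientation [IsManifold I ∞ M] (h : IsOrientation I M o) :
    letI := pullbackChartedSpace (H := H) hf
    letI := pullback_isManifold (I := I) hf
    IsOrientation I X (o ∘ f) := by
  let _ := pullbackChartedSpace (H := H) hf
  let _ := pullback_isManifold (I := I) hf
  intro x
  filter_upwards [(hf.continuous.tendsto x).eventually (h (f x))] with y hy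
  rw [tangentCoordChange_def] at hy ⊢
  rw [pullback_extChartAt, (pullback_coord hf y x).fderivWithin_eq]
  · exact hy
  · have := extChartAt_to_inv (I := I) y
    rw [pullback_extChartAt] at this
    simp only [Function.comp_apply, pullback_extChartAt, this, extChartAt_to_inv]

theorem pullback_boundary (x : X) :
    letI := pullbackChartedSpace (H := H) hf
    x ∈ I.boundary X ↔ f x ∈ I.boundary M := by
  let _ := pullbackChartedSpace (H := H) hf
  change extChartAt I x x ∈ frontier (Set.range I) ↔
    extChartAt I (f x) (f x) ∈ frontier (Set.range I)
  rw [pullback_extChartAt]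

end Pullback

end Manifold

noncomputable section

/-! ### Closed manifolds, diffeomorphisms, cobordisms -/

/-- A closed oriented smooth `n`-manifold. -/
structure ClosedManifold (n : ℕ) where
  carrier : Type u
  [top : TopologicalSpace carrier]
  [charted : ChartedSpace (EuclideanSpace ℝ (Fin n)) carrier]
  [smooth : IsManifold (𝓡 n) ∞ carrier]
  [t2 : T2Space carrier]
  [compact : CompactSpace carrier]
  orientation : carrier → Orientation ℝ (EuclideanSpace ℝ (Fin n)) (Fin n)
  isOrientation : IsOrientation (𝓡 n) carrier orientation

attribute [instance] ClosedManifold.top ClosedManifold.charted ClosedManifold.smooth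
  ClosedManifold.t2 ClosedManifold.compact

/-- Orientation preserving diffeomorphisms. -/
structure OrientedDiffeo {n : ℕ} (A B : ClosedManifold.{u} n) where
  map : A.carrier ≃ₘ^∞⟮𝓡 n, 𝓡 n⟯ B.carrier
  oriented : IsOrientedMap (𝓡 n) A.orientation B.orientation map

/-- For every basis `b` of the source of `T`, the vectors `v, T b₁, …, T bₙ` form a basis, which
is positive with respect to `o'` if and only if `b` is positive with respect to `o`. -/
def BoundaryOriented {n : ℕ} (v : EuclideanSpace ℝ (Fin (n + 1)))
    (T : EuclideanSpace ℝ (Fin n) →L[ℝ] EuclideanSpace ℝ (Fin (n + 1)))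
    (o : Orientation ℝ (EuclideanSpace ℝ (Fin n)) (Fin n))
    (o' : Orientation ℝ (EuclideanSpace ℝ (Fin (n + 1))) (Fin (n + 1))) : Prop :=
  ∀ b : Module.Basis (Fin n) ℝ (EuclideanSpace ℝ (Fin n)),
    ∃ b' : Module.Basis (Fin (n + 1)) ℝ (EuclideanSpace ℝ (Fin (n + 1))),
      ⇑b' = Fin.cons v (T ∘ b) ∧ (b.orientation = o ↔ b'.orientation = o')

/-- A cobordism from `A` to `B`: a compact oriented smooth `(n + 1)`-manifold whose boundary is
identified with `A ⊔ B`.  Putting a normal vector first, the orientation of `A` is the one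
induced by an inward normal, and that of `B` is the one induced by an outward normal. -/
structure Cobordism {n : ℕ} (A B : ClosedManifold.{u} n) where
  carrier : Type u
  [top : TopologicalSpace carrier]
  [charted : ChartedSpace (EuclideanHalfSpace (n + 1)) carrier]
  [smooth : IsManifold (𝓡∂ (n + 1)) ∞ carrier]
  [t2 : T2Space carrier]
  [compact : CompactSpace carrier]
  orientation : carrier → Orientation ℝ (EuclideanSpace ℝ (Fin (n + 1))) (Fin (n + 1))
  isOrientation : IsOrientation (𝓡∂ (n + 1)) carrier orientation
  inc : A.carrier → carrier
  out : B.carrier → carrier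
  inc_smooth : ContMDiff (𝓡 n) (𝓡∂ (n + 1)) ∞ inc
  out_smooth : ContMDiff (𝓡 n) (𝓡∂ (n + 1)) ∞ out
  inc_injective : Function.Injective inc
  out_injective : Function.Injective out
  disjoint : ∀ a b, inc a ≠ out b
  boundary_eq : (𝓡∂ (n + 1)).boundary carrier = Set.range inc ∪ Set.range out
  inc_oriented : ∀ a v, 0 < v 0 → BoundaryOriented v (tderiv (𝓡 n) (𝓡∂ (n + 1)) inc a)
    (A.orientation a) (orientation (inc a))
  out_oriented : ∀ b v, v 0 < 0 → BoundaryOriented v (tderiv (𝓡 n) (𝓡∂ (n + 1)) out b)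
    (B.orientation b) (orientation (out b))

attribute [instance] Cobordism.top Cobordism.charted Cobordism.smooth Cobordism.t2
  Cobordism.compact

namespace ClosedManifold

variable {n : ℕ}

/-- The empty manifold. -/
def empty (n : ℕ) : ClosedManifold.{u} n :=
  letI : ChartedSpace (EuclideanSpace ℝ (Fin n)) PEmpty.{u + 1} := ChartedSpace.empty _ _
  haveI : IsManifold (𝓡 n) ∞ PEmpty.{u + 1} := IsManifold.empty ∞
  { carrier := PEmpty.{u + 1}
    orientation := nofun
    isOrientation := nofun }

instance : IsEmpty (empty.{u} n).carrier := inferInstanceAs (IsEmpty PEmpty)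

/-- Disjoint union. -/
def sum (A B : ClosedManifold.{u} n) : ClosedManifold.{u} n where
  carrier := A.carrier ⊕ B.carrier
  orientation := Sum.elim A.orientation B.orientation
  isOrientation := A.isOrientation.sum B.isOrientation

end ClosedManifold

namespace OrientedDiffeo

variable {n : ℕ} {A B C D : ClosedManifold.{u} n}

/-- The identity. -/
def refl (A : ClosedManifold.{u} n) : OrientedDiffeo A A where
  map := .refl _ _ _
  oriented := .id _

/-- The inverse. -/
def symm (φ : OrientedDiffeo A B) : OrientedDiffeo B A where
  map := φ.map.symm
  oriented := φ.oriented.inverse φ.map.symm.contMDiff φ.map.symm_apply_apply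
    φ.map.apply_symm_apply

/-- The composite. -/
def trans (φ : OrientedDiffeo A B) (ψ : OrientedDiffeo B C) : OrientedDiffeo A C where
  map := φ.map.trans ψ.map
  oriented := ψ.oriented.comp φ.oriented

/-- The disjoint union of diffeomorphisms. -/
def sum (φ : OrientedDiffeo A B) (ψ : OrientedDiffeo C D) :
    OrientedDiffeo (A.sum C) (B.sum D) where
  map := φ.map.sumCongr ψ.map
  oriented := .of_sum (IsOrientedMap.inl.comp φ.oriented) (IsOrientedMap.inr.comp ψ.oriented)

/-- Associativity of disjoint unions. -/
def sumAssoc (A B C : ClosedManifold.{u} n) :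
    OrientedDiffeo ((A.sum B).sum C) (A.sum (B.sum C)) where
  map := Diffeomorph.sumAssoc (𝓡 n) A.carrier ∞ B.carrier C.carrier
  oriented := .of_sum (.of_sum .inl (IsOrientedMap.inr.comp .inl)) (IsOrientedMap.inr.comp .inr)

/-- Commutativity of disjoint unions. -/
def sumComm (A B : ClosedManifold.{u} n) : OrientedDiffeo (A.sum B) (B.sum A) where
  map := Diffeomorph.sumComm (𝓡 n) A.carrier ∞ B.carrier
  oriented := .of_sum .inr .inl

/-- Right unit law of disjoint unions. -/
def sumEmpty (A : ClosedManifold.{u} n) : OrientedDiffeo (A.sum (.empty n)) A where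
  map := Diffeomorph.sumEmpty (𝓡 n) A.carrier ∞
  oriented := .of_sum (.id _) ⟨fun x => isEmptyElim x, fun x => isEmptyElim x⟩

/-- Left unit law of disjoint unions. -/
def emptySum (A : ClosedManifold.{u} n) : OrientedDiffeo ((ClosedManifold.empty n).sum A) A :=
  (sumComm _ _).trans (sumEmpty A)

end OrientedDiffeo

namespace Cobordism

variable {n : ℕ} {A A' B B' C E : ClosedManifold.{u} n}

theorem tderiv_sumMap_inl {d d' : ℕ} {H H' : Type*} [TopologicalSpace H] [TopologicalSpace H']
    {I : ModelWithCorners ℝ (EuclideanSpace ℝ (Fin d)) H}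
    {J : ModelWithCorners ℝ (EuclideanSpace ℝ (Fin d')) H'} {M M' N N' : Type*}
    [TopologicalSpace M] [ChartedSpace H M] [TopologicalSpace M'] [ChartedSpace H M']
    [TopologicalSpace N] [ChartedSpace H' N] [TopologicalSpace N'] [ChartedSpace H' N']
    {f : M → N} {g : M' → N'} (hf : ContMDiff I J ∞ f) (hg : ContMDiff I J ∞ g) (x : M) :
    tderiv I J (Sum.map f g) (Sum.inl x) = tderiv I J f x := by
  have h := tderiv_comp (hf.sumMap hg) (ContMDiff.inl (I := I) (M := M) (M' := M')) x
  change tderiv I J (Sum.inl ∘ f) x = _ at h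
  rw [tderiv_comp .inl hf, tderiv_inl, tderiv_inl, ContinuousLinearMap.comp_id,
    ContinuousLinearMap.id_comp] at h
  exact h.symm

theorem tderiv_sumMap_inr {d d' : ℕ} {H H' : Type*} [TopologicalSpace H] [TopologicalSpace H']
    {I : ModelWithCorners ℝ (EuclideanSpace ℝ (Fin d)) H}
    {J : ModelWithCorners ℝ (EuclideanSpace ℝ (Fin d')) H'} {M M' N N' : Type*}
    [TopologicalSpace M] [ChartedSpace H M] [TopologicalSpace M'] [ChartedSpace H M']
    [TopologicalSpace N] [ChartedSpace H' N] [TopologicalSpace N'] [ChartedSpace H' N']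
    {f : M → N} {g : M' → N'} (hf : ContMDiff I J ∞ f) (hg : ContMDiff I J ∞ g) (x : M') :
    tderiv I J (Sum.map f g) (Sum.inr x) = tderiv I J g x := by
  have h := tderiv_comp (hf.sumMap hg) (ContMDiff.inr (I := I) (M := M) (M' := M')) x
  change tderiv I J (Sum.inr ∘ g) x = _ at h
  rw [tderiv_comp .inr hg, tderiv_inr, tderiv_inr, ContinuousLinearMap.comp_id,
    ContinuousLinearMap.id_comp] at h
  exact h.symm

/-- Disjoint union of cobordisms. -/
def sum (M : Cobordism A B) (N : Cobordism C E) : Cobordism (A.sum C) (B.sum E) where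
  carrier := M.carrier ⊕ N.carrier
  orientation := Sum.elim M.orientation N.orientation
  isOrientation := M.isOrientation.sum N.isOrientation
  inc := Sum.map M.inc N.inc
  out := Sum.map M.out N.out
  inc_smooth := M.inc_smooth.sumMap N.inc_smooth
  out_smooth := M.out_smooth.sumMap N.out_smooth
  inc_injective := M.inc_injective.sumMap N.inc_injective
  out_injective := M.out_injective.sumMap N.out_injective
  disjoint := by
    rintro (a | a) (b | b) <;> simp [Sum.map, M.disjoint, N.disjoint]
  boundary_eq := by
    rw [ModelWithCorners.boundary_disjointUnion, M.boundary_eq, N.boundary_eq]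
    ext (x | x) <;> simp [ClosedManifold.sum, Sum.exists]
  inc_oriented := by
    rintro (a | a) v hv
    · have := M.inc_oriented a v hv
      rwa [← tderiv_sumMap_inl M.inc_smooth N.inc_smooth] at this
    · have := N.inc_oriented a v hv
      rwa [← tderiv_sumMap_inr M.inc_smooth N.inc_smooth] at this
  out_oriented := by
    rintro (a | a) v hv
    · have := M.out_oriented a v hv
      rwa [← tderiv_sumMap_inl M.out_smooth N.out_smooth] at this
    · have := N.out_oriented a v hv
      rwa [← tderiv_sumMap_inr M.out_smooth N.out_smooth] at this

/-- Maps `j` and `j'` that exhibit `N` as the manifold obtained by gluing `M` and `M'` along `B`: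
they are smooth embeddings of codimension `0`, compatible with the orientations and the boundary
identifications, their images cover `N` and meet exactly in `B`. -/
structure IsGluingAlong (M : Cobordism A B) (M' : Cobordism B C) (N : Cobordism A C)
    (j : M.carrier → N.carrier) (j' : M'.carrier → N.carrier) : Prop where
  oriented : IsOrientedMap (𝓡∂ (n + 1)) M.orientation N.orientation j
  oriented' : IsOrientedMap (𝓡∂ (n + 1)) M'.orientation N.orientation j'
  injective : Function.Injective j
  injective' : Function.Injective j'
  cover : Set.range j ∪ Set.range j' = Set.univ
  seam : ∀ b, j (M.out b) = j' (M'.inc b)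
  inter : ∀ m m', j m = j' m' → ∃ b, m = M.out b ∧ m' = M'.inc b
  inc : ∀ a, j (M.inc a) = N.inc a
  out : ∀ c, j' (M'.out c) = N.out c

/-- The diffeomorphism `h` exhibits `M` as the cylinder `A × [0, 1]`, with the incoming boundary
at `0`, and the outgoing boundary at `1` and parametrized by `φ`. -/
structure IsCylinderVia (φ : OrientedDiffeo A B) (M : Cobordism A B)
    (h : (A.carrier × Set.Icc (0 : ℝ) 1) ≃ₘ^∞⟮(𝓡 n).prod (𝓡∂ 1), 𝓡∂ (n + 1)⟯ M.carrier) :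
    Prop where
  inc : ∀ a, h (a, 0) = M.inc a
  out : ∀ a, h (a, 1) = M.out (φ.map a)

/-- The diffeomorphism `h` of cobordisms preserves the orientations and restricts to `φ` and `ψ`
on the boundary. -/
structure IsDiffeoVia (φ : OrientedDiffeo A A') (ψ : OrientedDiffeo B B') (M : Cobordism A B)
    (N : Cobordism A' B') (h : M.carrier ≃ₘ^∞⟮𝓡∂ (n + 1), 𝓡∂ (n + 1)⟯ N.carrier) : Prop where
  oriented : IsOrientedMap (𝓡∂ (n + 1)) M.orientation N.orientation h
  inc : ∀ a, h (M.inc a) = N.inc (φ.map a)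
  out : ∀ b, h (M.out b) = N.out (ψ.map b)

end Cobordism

/-! ### Principal bundles and the category of `G`-cobordisms -/

/-- A principal `G`-bundle for the discrete group `G`, with `G` acting from the left.  As `proj`
is a covering map, the total space over a manifold has a unique smooth structure for which `proj`
is a local diffeomorphism. -/
structure PrincipalBundle (G : Type w) [Group G] (M : Type u) [TopologicalSpace M] where
  total : Type u
  [top : TopologicalSpace total]
  [action : MulAction G total]
  proj : total → M
  isCovering : IsQuotientCoveringMap proj G

attribute [instance] PrincipalBundle.top PrincipalBundle.action

namespace PrincipalBundle

variable {G : Type w} [Group G] {M N : Type u} [TopologicalSpace M] [TopologicalSpace N]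

/-- The empty bundle over the empty space. -/
def empty [IsEmpty M] : PrincipalBundle G M where
  total := PEmpty
  action := { smul := fun _ => nofun, one_smul := nofun, mul_smul := fun _ _ => nofun }
  proj := nofun
  isCovering :=
    letI : MulAction G PEmpty :=
      { smul := fun _ => nofun, one_smul := nofun, mul_smul := fun _ _ => nofun }
    (isQuotientCoveringMap_iff_isCoveringMap_and _ _).2 ⟨.of_isEmpty _, fun x => isEmptyElim x,
      ⟨fun _ => continuous_of_discreteTopology⟩, ⟨fun _ _ => nofun⟩, fun {x} => nomatch x⟩

/-- Disjoint union of bundles. -/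
def sum (P : PrincipalBundle G M) (Q : PrincipalBundle G N) : PrincipalBundle G (M ⊕ N) where
  total := P.total ⊕ Q.total
  proj := Sum.map P.proj Q.proj
  isCovering :=
    { toIsQuotientMap := IsOpenQuotientMap.isQuotientMap
        ⟨P.isCovering.surjective.sumMap Q.isCovering.surjective,
          P.isCovering.continuous.sumMap Q.isCovering.continuous,
          P.isCovering.isOpenQuotientMap.isOpenMap.sumMap
            Q.isCovering.isOpenQuotientMap.isOpenMap⟩
      continuous_const_smul := fun g =>
        (P.isCovering.continuous_const_smul g).sumMap (Q.isCovering.continuous_const_smul g)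
      apply_eq_iff_mem_orbit := by
        rintro (p | p) (q | q)
        · simpa [MulAction.mem_orbit_iff] using P.isCovering.apply_eq_iff_mem_orbit (e₁ := p)
        · simp [MulAction.mem_orbit_iff]
        · simp [MulAction.mem_orbit_iff]
        · simpa [MulAction.mem_orbit_iff] using Q.isCovering.apply_eq_iff_mem_orbit (e₁ := p)
      disjoint := by
        rintro (p | p)
        · obtain ⟨U, hU, h⟩ := P.isCovering.disjoint p
          refine ⟨Sum.inl '' U, ?_, fun g => ?_⟩
          · rw [nhds_inl]; exact Filter.image_mem_map hU
          · rintro ⟨_, ⟨_, ⟨x, hx, rfl⟩, rfl⟩, y, hy, hxy⟩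
            exact h g ⟨y, ⟨x, hx, (Sum.inl_injective hxy).symm⟩, hy⟩
        · obtain ⟨U, hU, h⟩ := Q.isCovering.disjoint p
          refine ⟨Sum.inr '' U, ?_, fun g => ?_⟩
          · rw [nhds_inr]; exact Filter.image_mem_map hU
          · rintro ⟨_, ⟨_, ⟨x, hx, rfl⟩, rfl⟩, y, hy, hxy⟩
            exact h g ⟨y, ⟨x, hx, (Sum.inr_injective hxy).symm⟩, hy⟩ }

/-- The map `F` of total spaces is a map of `G`-bundles over `f`. -/
structure IsMap (P : PrincipalBundle G M) (Q : PrincipalBundle G N) (f : M → N)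
    (F : P.total → Q.total) : Prop where
  continuous : Continuous F
  smul : ∀ (g : G) p, F (g • p) = g • F p
  proj : ∀ p, Q.proj (F p) = f (P.proj p)

theorem IsMap.sum {M' N' : Type u} [TopologicalSpace M'] [TopologicalSpace N']
    {P : PrincipalBundle G M} {Q : PrincipalBundle G N} {P' : PrincipalBundle G M'}
    {Q' : PrincipalBundle G N'} {f : M → N} {F : P.total → Q.total} {f' : M' → N'}
    {F' : P'.total → Q'.total} (h : IsMap P Q f F) (h' : IsMap P' Q' f' F') :
    IsMap (P.sum P') (Q.sum Q') (Sum.map f f') (Sum.map F F') where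
  continuous := h.continuous.sumMap h'.continuous
  smul := by
    rintro g (p | p)
    · exact congrArg Sum.inl (h.smul g p)
    · exact congrArg Sum.inr (h'.smul g p)
  proj := by
    rintro (p | p)
    · exact congrArg Sum.inl (h.proj p)
    · exact congrArg Sum.inr (h'.proj p)

/-! ### The associated bundle -/

variable (X : Type u) [TopologicalSpace X] [DiscreteTopology X] [MulAction G X]

/-- The associated bundle `X ×_G P`, the quotient of `X × P` by the relation
`(g⁻¹ • x, p) ∼ (x, g • p)`. -/
def Assoc (P : PrincipalBundle G M) : Type u := MulAction.orbitRel.Quotient G (X × P.total)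

instance (P : PrincipalBundle G M) : TopologicalSpace (P.Assoc X) :=
  inferInstanceAs (TopologicalSpace (Quotient (MulAction.orbitRel G (X × P.total))))

variable {X}

/-- The class of a pair in `X ×_G P`. -/
def cls (P : PrincipalBundle G M) (x : X) (p : P.total) : P.Assoc X :=
  Quotient.mk (MulAction.orbitRel G (X × P.total)) (x, p)

theorem cls_eq_iff (P : PrincipalBundle G M) {x y : X} {p q : P.total} :
    P.cls x p = P.cls y q ↔ ∃ g : G, g • y = x ∧ g • q = p := by
  refine Quotient.eq.trans ?_
  rw [MulAction.orbitRel_apply, MulAction.mem_orbit_iff]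
  simp [Prod.ext_iff]

theorem cls_smul (P : PrincipalBundle G M) (g : G) (x : X) (p : P.total) :
    P.cls (g⁻¹ • x) p = P.cls x (g • p) :=
  P.cls_eq_iff.2 ⟨g⁻¹, rfl, inv_smul_smul _ _⟩

theorem proj_smul (P : PrincipalBundle G M) (g : G) (p : P.total) : P.proj (g • p) = P.proj p :=
  P.isCovering.apply_eq_iff_mem_orbit.2 ⟨g, rfl⟩

/-- The bundle projection `X ×_G P → M`. -/
def assocProj (P : PrincipalBundle G M) : P.Assoc X → M :=
  Quotient.lift (fun xp => P.proj xp.2) (by rintro _ ⟨x, p⟩ ⟨g, rfl⟩; exact P.proj_smul g p)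

@[simp] theorem assocProj_cls (P : PrincipalBundle G M) (x : X) (p : P.total) :
    P.assocProj (P.cls x p) = P.proj p := rfl

theorem cls_surj (P : PrincipalBundle G M) (z : P.Assoc X) : ∃ x p, P.cls x p = z := by
  obtain ⟨⟨x, p⟩, rfl⟩ := Quotient.exists_rep z
  exact ⟨x, p, rfl⟩

theorem continuousConstSMul (P : PrincipalBundle G M) : ContinuousConstSMul G P.total :=
  P.isCovering.toContinuousConstSMul

theorem continuousConstSMul_prod (P : PrincipalBundle G M) :
    ContinuousConstSMul G (X × P.total) := by
  have := P.continuousConstSMul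
  have : ContinuousConstSMul G X := ⟨fun _ => continuous_of_discreteTopology⟩
  infer_instance

theorem continuous_cls (P : PrincipalBundle G M) :
    Continuous fun z : X × P.total => P.cls z.1 z.2 := continuous_quot_mk

theorem isOpenMap_cls (P : PrincipalBundle G M) :
    IsOpenMap fun z : X × P.total => P.cls z.1 z.2 := by
  have := P.continuousConstSMul_prod (X := X)
  exact isOpenMap_quotient_mk'_mul

theorem continuous_assocProj (P : PrincipalBundle G M) :
    Continuous (P.assocProj : P.Assoc X → M) :=
  Continuous.quotient_lift (P.isCovering.continuous.comp continuous_snd) _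

theorem assocProj_isLocalHomeomorph (P : PrincipalBundle G M) :
    IsLocalHomeomorph (P.assocProj : P.Assoc X → M) := by
  have := P.continuousConstSMul_prod (X := X)
  have hq : IsQuotientCoveringMap (fun z : X × P.total => P.cls z.1 z.2) G :=
    { toIsQuotientMap := isQuotientMap_quotient_mk'
      continuous_const_smul := this.continuous_const_smul
      apply_eq_iff_mem_orbit := Quotient.eq''
      disjoint := by
        rintro ⟨x, p⟩
        obtain ⟨U, hU, h⟩ := P.isCovering.disjoint p
        refine ⟨Set.univ ×ˢ U, prod_mem_nhds Filter.univ_mem hU, fun g => ?_⟩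
        rintro ⟨_, ⟨⟨y, q⟩, hq, rfl⟩, hq'⟩
        exact h g ⟨g • q, ⟨q, hq.2, rfl⟩, hq'.2⟩ }
  intro z
  obtain ⟨x, p, rfl⟩ := P.cls_surj z
  have hx : IsOpenEmbedding fun p : P.total => (x, p) := by
    refine .of_continuous_injective_isOpenMap (by fun_prop) (fun _ _ h => (Prod.ext_iff.1 h).2) ?_
    intro U hU
    have : (fun p : P.total => (x, p)) '' U = {x} ×ˢ U := by ext ⟨y, q⟩; aesop
    rw [this]
    exact (isOpen_discrete _).prod hU
  have hs : IsLocalHomeomorph fun p : P.total => P.cls x p :=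
    hq.isCoveringMap.isLocalHomeomorph.comp hx.isLocalHomeomorph
  have hp : IsLocalHomeomorph (P.assocProj ∘ fun p : P.total => P.cls x p) :=
    P.isCovering.isCoveringMap.isLocalHomeomorph
  exact (hp.isLocalHomeomorphOn (s := {p})).of_comp_right hs.isLocalHomeomorphOn _ ⟨p, rfl, rfl⟩

theorem t2Space_total [T2Space M] (P : PrincipalBundle G M) : T2Space P.total := by
  refine ⟨fun p q hpq => ?_⟩
  by_cases h : P.proj p = P.proj q
  · exact P.isCovering.isCoveringMap.isSeparatedMap p q h hpq
  · obtain ⟨U, V, hU, hV, hp, hq, hd⟩ := t2_separation h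
    exact ⟨_, _, hU.preimage P.isCovering.continuous, hV.preimage P.isCovering.continuous, hp, hq,
      hd.preimage _⟩

theorem compactSpace_total [Finite G] [CompactSpace M] (P : PrincipalBundle G M) :
    CompactSpace P.total := by
  have := P.continuousConstSMul
  have h : IsProperMap P.proj := by
    refine isProperMap_iff_isClosedMap_and_compact_fibers.2 ⟨P.isCovering.continuous, ?_, ?_⟩
    · intro C hC
      rw [← P.isCovering.toIsQuotientMap.isClosed_preimage]
      have : P.proj ⁻¹' (P.proj '' C) = ⋃ g : G, (fun p => g • p) '' C := by
        ext p
        simp only [Set.mem_preimage, Set.mem_image, Set.mem_iUnion]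
        constructor
        · rintro ⟨q, hq, h⟩
          obtain ⟨g, hg⟩ := P.isCovering.apply_eq_iff_mem_orbit.1 h.symm
          exact ⟨g, q, hq, hg⟩
        · rintro ⟨g, q, hq, rfl⟩
          exact ⟨q, hq, (P.proj_smul g q).symm⟩
      rw [this]
      exact isClosed_iUnion_of_finite fun g => (Homeomorph.smul g).isClosedMap C hC
    · intro m
      obtain ⟨p, rfl⟩ := P.isCovering.surjective m
      refine Set.Finite.isCompact ((Set.finite_range fun g : G => g • p).subset ?_)
      intro q hq
      exact P.isCovering.apply_eq_iff_mem_orbit.1 hq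
  exact ⟨by simpa using h.isCompact_preimage isCompact_univ⟩

theorem t2Space_assoc [Finite G] [T2Space M] [CompactSpace M] (P : PrincipalBundle G M) :
    T2Space (P.Assoc X) := by
  have := P.t2Space_total
  have := P.compactSpace_total
  have := P.continuousConstSMul_prod (X := X)
  exact inferInstanceAs (T2Space (Quotient (MulAction.orbitRel G (X × P.total))))

theorem compactSpace_assoc [Finite G] [Finite X] [CompactSpace M] (P : PrincipalBundle G M) :
    CompactSpace (P.Assoc X) := by
  have := P.compactSpace_total
  have := Finite.compactSpace (X := X)
  exact inferInstanceAs (CompactSpace (Quotient (MulAction.orbitRel G (X × P.total))))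

/-- The map of associated bundles induced by a bundle map. -/
def assocMap {P : PrincipalBundle G M} {Q : PrincipalBundle G N} {f : M → N}
    {F : P.total → Q.total} (h : IsMap P Q f F) : P.Assoc X → Q.Assoc X :=
  Quotient.lift (fun xp => Q.cls xp.1 (F xp.2)) (by
    rintro _ ⟨x, p⟩ ⟨g, rfl⟩
    exact Q.cls_eq_iff.2 ⟨g, rfl, (h.smul g p).symm⟩)

section

variable {P : PrincipalBundle G M} {Q : PrincipalBundle G N} {f : M → N}
    {F : P.total → Q.total} (h : IsMap P Q f F)

theorem continuous_assocMap : Continuous (assocMap h : P.Assoc X → Q.Assoc X) :=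
  Continuous.quotient_lift
    (Q.continuous_cls.comp (continuous_fst.prodMk (h.continuous.comp continuous_snd))) _

theorem assocProj_assocMap (z : P.Assoc X) :
    Q.assocProj (assocMap h z) = f (P.assocProj z) := by
  obtain ⟨x, p, rfl⟩ := P.cls_surj z
  exact h.proj p

theorem assocMap_cls (x : X) (p : P.total) : assocMap h (P.cls x p) = Q.cls x (F p) := rfl

theorem assocMap_injective (hf : Function.Injective f) :
    Function.Injective (assocMap h : P.Assoc X → Q.Assoc X) := by
  intro z z' hz
  obtain ⟨x, p, rfl⟩ := P.cls_surj z
  obtain ⟨y, q, rfl⟩ := P.cls_surj z'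
  have hpq := congrArg Q.assocProj hz
  rw [assocProj_assocMap, assocProj_assocMap] at hpq
  obtain ⟨g, hg⟩ := P.isCovering.apply_eq_iff_mem_orbit.1 (hf hpq)
  have hg : g • q = p := hg
  rw [assocMap_cls, assocMap_cls, cls_eq_iff] at hz
  obtain ⟨k, hk, hk'⟩ := hz
  have := Q.isCovering.isCancelSMul
  have hgk : k = g := by
    rw [← hg, h.smul] at hk'
    exact IsCancelSMul.right_cancel _ _ _ hk'
  subst hgk
  exact P.cls_eq_iff.2 ⟨k, hk, hg⟩

theorem range_assocMap :
    Set.range (assocMap h : P.Assoc X → Q.Assoc X) = Q.assocProj ⁻¹' Set.range f := by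
  ext z
  constructor
  · rintro ⟨z, rfl⟩
    exact ⟨_, (assocProj_assocMap h z).symm⟩
  · obtain ⟨x, q, rfl⟩ := Q.cls_surj z
    rintro ⟨m, hm⟩
    obtain ⟨p, rfl⟩ := P.isCovering.surjective m
    rw [← h.proj, assocProj_cls] at hm
    obtain ⟨g, hg⟩ := Q.isCovering.apply_eq_iff_mem_orbit.1 hm
    have hg : g • q = F p := hg
    exact ⟨P.cls (g • x) p, Q.cls_eq_iff.2 ⟨g, rfl, hg⟩⟩

end

end PrincipalBundle

/-- An object of the category of `G`-cobordisms: a principal `G`-bundle over a closed oriented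
`n`-manifold, with a marked point on each connected component of the total space. -/
structure GManifold (G : Type w) [Group G] (n : ℕ) where
  base : ClosedManifold.{u} n
  bundle : PrincipalBundle.{u} G base.carrier
  marked : Set bundle.total
  existsUnique_marked : ∀ p, ∃! e, e ∈ marked ∧ e ∈ connectedComponent p

/-- Isomorphisms of `G`-bundles over orientation preserving diffeomorphisms; they need not preserve
the marked points. -/
structure GDiffeo {G : Type w} [Group G] {n : ℕ} (P Q : GManifold.{u} G n) where
  base : OrientedDiffeo P.base Q.base
  total : P.bundle.total ≃ₜ Q.bundle.total
  isMap : P.bundle.IsMap Q.bundle base.map total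

/-- A `G`-cobordism from `P` to `Q`: a principal `G`-bundle over a cobordism of the base manifolds,
with identifications of its restrictions to the boundary with `P` and `Q`. -/
structure GCobordism {G : Type w} [Group G] {n : ℕ} (P Q : GManifold.{u} G n) where
  base : Cobordism P.base Q.base
  bundle : PrincipalBundle.{u} G base.carrier
  inc : P.bundle.total → bundle.total
  out : Q.bundle.total → bundle.total
  inc_isMap : P.bundle.IsMap bundle base.inc inc
  out_isMap : Q.bundle.IsMap bundle base.out out

namespace GManifold

variable {G : Type w} [Group G] {n : ℕ}

variable (G n) in
/-- The empty bundle over the empty manifold. -/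
def empty : GManifold.{u} G n where
  base := .empty n
  bundle := .empty
  marked := ∅
  existsUnique_marked := nofun

theorem connectedComponent_inl {A B : Type*} [TopologicalSpace A] [TopologicalSpace B] (a : A) :
    connectedComponent (Sum.inl a : A ⊕ B) = Sum.inl '' connectedComponent a := by
  refine Set.Subset.antisymm (fun z hz => ?_)
    (continuous_inl.image_connectedComponent_subset a)
  have hr := isClopen_range_inl.connectedComponent_subset (Set.mem_range_self a) hz
  obtain ⟨b, rfl⟩ := hr
  refine ⟨b, ?_, rfl⟩
  have h : IsPreconnected (Sum.inl ⁻¹' connectedComponent (Sum.inl a : A ⊕ B)) :=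
    isPreconnected_connectedComponent.preimage_of_isOpenMap Sum.inl_injective isOpenMap_inl
      (isClopen_range_inl.connectedComponent_subset (Set.mem_range_self a))
  exact h.subset_connectedComponent (show a ∈ _ from mem_connectedComponent) hz

theorem connectedComponent_inr {A B : Type*} [TopologicalSpace A] [TopologicalSpace B] (b : B) :
    connectedComponent (Sum.inr b : A ⊕ B) = Sum.inr '' connectedComponent b := by
  refine Set.Subset.antisymm (fun z hz => ?_)
    (continuous_inr.image_connectedComponent_subset b)
  have hr := isClopen_range_inr.connectedComponent_subset (Set.mem_range_self b) hz
  obtain ⟨c, rfl⟩ := hr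
  refine ⟨c, ?_, rfl⟩
  have h : IsPreconnected (Sum.inr ⁻¹' connectedComponent (Sum.inr b : A ⊕ B)) :=
    isPreconnected_connectedComponent.preimage_of_isOpenMap Sum.inr_injective isOpenMap_inr
      (isClopen_range_inr.connectedComponent_subset (Set.mem_range_self b))
  exact h.subset_connectedComponent (show b ∈ _ from mem_connectedComponent) hz

/-- Disjoint union. -/
def sum (P Q : GManifold.{u} G n) : GManifold.{u} G n where
  base := P.base.sum Q.base
  bundle := P.bundle.sum Q.bundle
  marked := Sum.inl '' P.marked ∪ Sum.inr '' Q.marked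
  existsUnique_marked := by
    rintro (p | p)
    · obtain ⟨e, ⟨he, he'⟩, hu⟩ := P.existsUnique_marked p
      have hc := connectedComponent_inl (B := Q.bundle.total) p
      refine ⟨Sum.inl e, ⟨Or.inl ⟨e, he, rfl⟩, ?_⟩, ?_⟩
      · exact hc.symm ▸ ⟨e, he', rfl⟩
      · rintro z ⟨hz, hz'⟩
        obtain ⟨q, hq, rfl⟩ : z ∈ Sum.inl '' connectedComponent p := hc ▸ hz'
        rcases hz with ⟨q', hq', h⟩ | ⟨q', hq', h⟩
        · cases h
          exact congrArg Sum.inl (hu q ⟨hq', hq⟩)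
        · cases h
    · obtain ⟨e, ⟨he, he'⟩, hu⟩ := Q.existsUnique_marked p
      have hc := connectedComponent_inr (A := P.bundle.total) p
      refine ⟨Sum.inr e, ⟨Or.inr ⟨e, he, rfl⟩, ?_⟩, ?_⟩
      · exact hc.symm ▸ ⟨e, he', rfl⟩
      · rintro z ⟨hz, hz'⟩
        obtain ⟨q, hq, rfl⟩ : z ∈ Sum.inr '' connectedComponent p := hc ▸ hz'
        rcases hz with ⟨q', hq', h⟩ | ⟨q', hq', h⟩
        · cases h
        · cases h
          exact congrArg Sum.inr (hu q ⟨hq', hq⟩)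

end GManifold

namespace GDiffeo

variable {G : Type w} [Group G] {n : ℕ} {P Q R S : GManifold.{u} G n}

/-- The identity. -/
def refl (P : GManifold.{u} G n) : GDiffeo P P where
  base := .refl _
  total := .refl _
  isMap := ⟨continuous_id, fun _ _ => rfl, fun _ => rfl⟩

/-- The inverse. -/
def symm (φ : GDiffeo P Q) : GDiffeo Q P where
  base := φ.base.symm
  total := φ.total.symm
  isMap :=
    { continuous := φ.total.symm.continuous
      smul := fun g q => by
        obtain ⟨p, rfl⟩ := φ.total.surjective q
        rw [← φ.isMap.smul]; simp
      proj := fun q => by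
        obtain ⟨p, rfl⟩ := φ.total.surjective q
        rw [φ.isMap.proj, Homeomorph.symm_apply_apply]
        exact (φ.base.map.symm_apply_apply _).symm }

/-- The composite. -/
def trans (φ : GDiffeo P Q) (ψ : GDiffeo Q R) : GDiffeo P R where
  base := φ.base.trans ψ.base
  total := φ.total.trans ψ.total
  isMap :=
    { continuous := (φ.total.trans ψ.total).continuous
      smul := fun g p => by simp [φ.isMap.smul, ψ.isMap.smul]
      proj := fun p => by simp [φ.isMap.proj, ψ.isMap.proj, OrientedDiffeo.trans] }

/-- The disjoint union of isomorphisms. -/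
def sum (φ : GDiffeo P Q) (ψ : GDiffeo R S) : GDiffeo (P.sum R) (Q.sum S) where
  base := φ.base.sum ψ.base
  total := φ.total.sumCongr ψ.total
  isMap := φ.isMap.sum ψ.isMap

/-- Associativity of disjoint unions. -/
def sumAssoc (P Q R : GManifold.{u} G n) : GDiffeo ((P.sum Q).sum R) (P.sum (Q.sum R)) where
  base := .sumAssoc _ _ _
  total := Homeomorph.sumAssoc _ _ _
  isMap :=
    { continuous := (Homeomorph.sumAssoc _ _ _).continuous
      smul := by rintro g ((p | p) | p) <;> rfl
      proj := by rintro ((p | p) | p) <;> rfl }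

/-- Commutativity of disjoint unions. -/
def sumComm (P Q : GManifold.{u} G n) : GDiffeo (P.sum Q) (Q.sum P) where
  base := .sumComm _ _
  total := Homeomorph.sumComm _ _
  isMap :=
    { continuous := (Homeomorph.sumComm _ _).continuous
      smul := by rintro g (p | p) <;> rfl
      proj := by rintro (p | p) <;> rfl }

instance : IsEmpty (GManifold.empty.{u} G n).bundle.total := inferInstanceAs (IsEmpty PEmpty)

/-- Right unit law of disjoint unions. -/
def sumEmpty (P : GManifold.{u} G n) : GDiffeo (P.sum (.empty G n)) P where
  base := .sumEmpty _
  total := Homeomorph.sumEmpty _ _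
  isMap :=
    { continuous := (Homeomorph.sumEmpty _ _).continuous
      smul := by
        rintro g (p | p)
        · rfl
        · exact isEmptyElim (α := (GManifold.empty.{u} G n).bundle.total) p
      proj := by
        rintro (p | p)
        · rfl
        · exact isEmptyElim (α := (GManifold.empty.{u} G n).bundle.total) p }

/-- Left unit law of disjoint unions. -/
def emptySum (P : GManifold.{u} G n) : GDiffeo ((GManifold.empty G n).sum P) P :=
  (sumComm _ _).trans (sumEmpty P)

end GDiffeo

namespace GCobordism

variable {G : Type w} [Group G] {n : ℕ} {P P' Q Q' R S : GManifold.{u} G n}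

/-- Disjoint union of `G`-cobordisms. -/
def sum (M : GCobordism P Q) (N : GCobordism R S) : GCobordism (P.sum R) (Q.sum S) where
  base := M.base.sum N.base
  bundle := M.bundle.sum N.bundle
  inc := Sum.map M.inc N.inc
  out := Sum.map M.out N.out
  inc_isMap := M.inc_isMap.sum N.inc_isMap
  out_isMap := M.out_isMap.sum N.out_isMap

/-- `N` is obtained by gluing `M` and `M'` along `Q`, both for the bases and for the bundles. -/
def IsGluing (M : GCobordism P Q) (M' : GCobordism Q R) (N : GCobordism P R) : Prop :=
  ∃ (j : M.base.carrier → N.base.carrier) (j' : M'.base.carrier → N.base.carrier)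
    (J : M.bundle.total → N.bundle.total) (J' : M'.bundle.total → N.bundle.total),
    Cobordism.IsGluingAlong M.base M'.base N.base j j' ∧
    M.bundle.IsMap N.bundle j J ∧ M'.bundle.IsMap N.bundle j' J' ∧
    (∀ q, J (M.out q) = J' (M'.inc q)) ∧
    (∀ p, J (M.inc p) = N.inc p) ∧ (∀ r, J' (M'.out r) = N.out r)

/-- `M` is the cylinder `P × [0, 1]`, with the outgoing boundary parametrized by `φ`. -/
def IsCylinder (φ : GDiffeo P Q) (M : GCobordism P Q) : Prop :=
  ∃ (h : (P.base.carrier × Set.Icc (0 : ℝ) 1) ≃ₘ^∞⟮(𝓡 n).prod (𝓡∂ 1), 𝓡∂ (n + 1)⟯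
      M.base.carrier) (F : P.bundle.total × Set.Icc (0 : ℝ) 1 ≃ₜ M.bundle.total),
    Cobordism.IsCylinderVia φ.base M.base h ∧
    (∀ (g : G) p t, F (g • p, t) = g • F (p, t)) ∧
    (∀ p t, M.bundle.proj (F (p, t)) = h (P.bundle.proj p, t)) ∧
    (∀ p, F (p, 0) = M.inc p) ∧ (∀ p, F (p, 1) = M.out (φ.total p))

/-- There is an isomorphism of `G`-cobordisms that restricts to `φ` and `ψ` on the boundary. -/
def IsDiffeo (φ : GDiffeo P P') (ψ : GDiffeo Q Q') (M : GCobordism P Q)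
    (N : GCobordism P' Q') : Prop :=
  ∃ (h : M.base.carrier ≃ₘ^∞⟮𝓡∂ (n + 1), 𝓡∂ (n + 1)⟯ N.base.carrier)
    (F : M.bundle.total ≃ₜ N.bundle.total),
    Cobordism.IsDiffeoVia φ.base ψ.base M.base N.base h ∧
    M.bundle.IsMap N.bundle h F ∧
    (∀ p, F (M.inc p) = N.inc (φ.total p)) ∧ (∀ q, F (M.out q) = N.out (ψ.total q))

end GCobordism

/-! ### The categories of cobordisms and of `G`-cobordisms -/

/-- Closed oriented `n`-manifolds and their cobordisms. -/
def cobData (n : ℕ) : CobordismData.{u + 1, u} where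
  Obj := ClosedManifold.{u} n
  unit := .empty n
  sum := .sum
  Iso := OrientedDiffeo
  refl := .refl
  symm := .symm
  trans := .trans
  sumIso := .sum
  sumAssoc := .sumAssoc
  emptySum := .emptySum
  sumEmpty := .sumEmpty
  sumComm := .sumComm
  Bord := Cobordism
  sumBord := .sum
  IsGluing M M' N := ∃ j j', Cobordism.IsGluingAlong M M' N j j'
  IsCylinder φ M := ∃ h, Cobordism.IsCylinderVia φ M h
  IsDiffeo φ ψ M N := ∃ h, Cobordism.IsDiffeoVia φ ψ M N h

/-- Principal `G`-bundles over closed oriented `n`-manifolds and `G`-cobordisms. -/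
def gcobData (G : Type w) [Group G] (n : ℕ) : CobordismData.{max (u + 1) w, u} where
  Obj := GManifold.{u} G n
  unit := .empty G n
  sum := .sum
  Iso := GDiffeo
  refl := .refl
  symm := .symm
  trans := .trans
  sumIso := .sum
  sumAssoc := .sumAssoc
  emptySum := .emptySum
  sumEmpty := .sumEmpty
  sumComm := .sumComm
  Bord := GCobordism
  sumBord := .sum
  IsGluing := GCobordism.IsGluing
  IsCylinder := GCobordism.IsCylinder
  IsDiffeo := GCobordism.IsDiffeo

/-- The symmetric monoidal category of closed oriented `n`-manifolds and `(n + 1)`-dimensional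
cobordisms. -/
abbrev Cob (n : ℕ) := (cobData.{u} n).Cat

/-- The symmetric monoidal category of principal `G`-bundles over closed oriented `n`-manifolds and
`(n + 1)`-dimensional `G`-cobordisms. -/
abbrev GCob (G : Type w) [Group G] (n : ℕ) := (gcobData.{u} G n).Cat

/-! ### The cover functor -/

section Cover

variable {G : Type w} [Group G] [Finite G] {n : ℕ} (X : Type u) [TopologicalSpace X]
  [DiscreteTopology X] [Finite X] [MulAction G X]

/-- The closed oriented manifold `X ×_G P`. -/
def assocManifold (P : GManifold.{u} G n) : ClosedManifold.{u} n where
  carrier := P.bundle.Assoc X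
  charted := pullbackChartedSpace P.bundle.assocProj_isLocalHomeomorph
  smooth := pullback_isManifold P.bundle.assocProj_isLocalHomeomorph
  t2 := P.bundle.t2Space_assoc
  compact := P.bundle.compactSpace_assoc
  orientation := P.base.orientation ∘ P.bundle.assocProj
  isOrientation := pullback_isOrientation P.bundle.assocProj_isLocalHomeomorph
    P.base.isOrientation

/-- The cobordism `X ×_G M`. -/
def assocCobordism {P Q : GManifold.{u} G n} (M : GCobordism P Q) :
    Cobordism (assocManifold X P) (assocManifold X Q) where
  carrier := M.bundle.Assoc X
  charted := pullbackChartedSpace M.bundle.assocProj_isLocalHomeomorph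
  smooth := pullback_isManifold M.bundle.assocProj_isLocalHomeomorph
  t2 := M.bundle.t2Space_assoc
  compact := M.bundle.compactSpace_assoc
  orientation := M.base.orientation ∘ M.bundle.assocProj
  isOrientation := pullback_isOrientation M.bundle.assocProj_isLocalHomeomorph
    M.base.isOrientation
  inc := PrincipalBundle.assocMap M.inc_isMap
  out := PrincipalBundle.assocMap M.out_isMap
  inc_smooth := (pullback_lift _ _ (PrincipalBundle.continuous_assocMap M.inc_isMap)
    M.base.inc_smooth (PrincipalBundle.assocProj_assocMap _)).1
  out_smooth := (pullback_lift _ _ (PrincipalBundle.continuous_assocMap M.out_isMap)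
    M.base.out_smooth (PrincipalBundle.assocProj_assocMap _)).1
  inc_injective := PrincipalBundle.assocMap_injective _ M.base.inc_injective
  out_injective := PrincipalBundle.assocMap_injective _ M.base.out_injective
  disjoint a b h := by
    exact M.base.disjoint _ _ (((PrincipalBundle.assocProj_assocMap M.inc_isMap a).symm.trans
      (congrArg M.bundle.assocProj h)).trans (PrincipalBundle.assocProj_assocMap M.out_isMap b))
  boundary_eq := by
    ext z
    rw [pullback_boundary, M.base.boundary_eq]
    erw [PrincipalBundle.range_assocMap, PrincipalBundle.range_assocMap]
    rfl
  inc_oriented a v hv := by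
    have h := M.base.inc_oriented (P.bundle.assocProj a) v hv
    have h2 := (pullback_lift (P.bundle.assocProj_isLocalHomeomorph (X := X))
      M.bundle.assocProj_isLocalHomeomorph
      (PrincipalBundle.continuous_assocMap M.inc_isMap)
      M.base.inc_smooth (PrincipalBundle.assocProj_assocMap _)).2 a
    have h3 := PrincipalBundle.assocProj_assocMap M.inc_isMap a
    rw [← h2, ← h3] at h
    exact h
  out_oriented a v hv := by
    have h := M.base.out_oriented (Q.bundle.assocProj a) v hv
    have h2 := (pullback_lift (Q.bundle.assocProj_isLocalHomeomorph (X := X))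
      M.bundle.assocProj_isLocalHomeomorph
      (PrincipalBundle.continuous_assocMap M.out_isMap)
      M.base.out_smooth (PrincipalBundle.assocProj_assocMap _)).2 a
    have h3 := PrincipalBundle.assocProj_assocMap M.out_isMap a
    rw [← h2, ← h3] at h
    exact h

open Functor.LaxMonoidal CobordismData in
/-- The symmetric monoidal functor `F` is the cover functor `P ↦ X ×_G P`: it has the evident
values on objects, cobordisms and diffeomorphisms, and its structure isomorphisms are the evident
diffeomorphisms. -/
structure IsCoverFunctor (F : GCob.{u} G n ⥤ Cob.{u} n) [F.Braided] : Prop where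
  obj (P : GManifold.{u} G n) : F.obj ⟨P⟩ = ⟨assocManifold X P⟩
  map_cobordism {P Q : GManifold.{u} G n} (M : GCobordism P Q) :
    F.map (bordHom (D := gcobData G n) M) =
      eqToHom (obj P) ≫ bordHom (D := cobData n) (assocCobordism X M) ≫ eqToHom (obj Q).symm
  map_diffeo {P Q : GManifold.{u} G n} (φ : GDiffeo P Q) :
    ∃ ψ : OrientedDiffeo (assocManifold X P) (assocManifold X Q),
      (∀ (x : X) p, ψ.map (P.bundle.cls x p) = Q.bundle.cls x (φ.total p)) ∧
      F.map (isoHom (D := gcobData G n) φ).hom =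
        eqToHom (obj P) ≫ (isoHom (D := cobData n) ψ).hom ≫ eqToHom (obj Q).symm
  unit : ∃ ψ : OrientedDiffeo (.empty n) (assocManifold X (.empty G n)),
    ε F = (isoHom (D := cobData n) ψ).hom ≫ eqToHom (obj (.empty G n)).symm
  tensor (P Q : GManifold.{u} G n) :
    ∃ ψ : OrientedDiffeo ((assocManifold X P).sum (assocManifold X Q)) (assocManifold X (P.sum Q)),
      (∀ (x : X) p, ψ.map (.inl (P.bundle.cls x p)) = (P.sum Q).bundle.cls x (.inl p)) ∧
      (∀ (x : X) q, ψ.map (.inr (Q.bundle.cls x q)) = (P.sum Q).bundle.cls x (.inr q)) ∧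
      μ F ⟨P⟩ ⟨Q⟩ = MonoidalCategory.tensorHom (eqToHom (obj P)) (eqToHom (obj Q)) ≫
        (isoHom (D := cobData n) ψ).hom ≫ eqToHom (obj (P.sum Q)).symm

end Cover

end

end TFT

/-! Morphisms of `GCob` and `Cob` are words in cobordisms and diffeomorphisms modulo relations, so a
functor between them amounts to values on generators that respect the relations. The geometry of `P
↦ X ×_G P` rests on two facts.

The local fact: charts and orientation of `X ×_G P` are pulled back along the projection to the
base, which is a local homeomorphism. In these charts the projection is the identity. A continuous
map into the covering is therefore smooth, or orientation preserving, as soon as its composite with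
the projection is (`contMDiff_of_assocProj_comp`, `isOrientedMap_of_assocProj_comp`).

The fibrewise fact: a bundle map `F` over `f` induces `[x, p] ↦ [x, F p]`. The group acts simply
transitively on the fibres, so the image of this map is the whole preimage of the range of `f`, and
the map is injective when `f` is (`range_assocMap`, `assocMap_injective`). Consequently gluings,
cylinders and isomorphisms of `G`-cobordisms induce gluings, cylinders and isomorphisms of the
associated coverings.

Disjoint unions are preserved only up to the evident diffeomorphism `μ`. The passage from geometry
to categories is isolated in `Morphism`: a formal disjoint union of words is sent to the tensor
product conjugated by `μ`. The naturality relations then follow from naturality in the target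
together with the coherence of `μ`. The relations between structure diffeomorphisms alone follow
because they are equalities of diffeomorphisms already in the source (`isCoherent_gcobData`).
Induction over the relations (`wordMap_eq`) gives the functor, and its monoidal and symmetry laws
are the coherence laws of `μ`, which can be read off on classes `[x, p]`. Composing with `Z` is then
composition of braided functors. -/

namespace TFT

/-! ### Maps of cobordism data and their coherence. -/

namespace CobordismData

open MonoidalCategory

universe v' w'

/-- A map between cobordism data that preserves disjoint unions up to coherent diffeomorphism and
respects the geometric relations. -/
structure Morphism (D : CobordismData.{v, w}) (D' : CobordismData.{v', w'}) where
  obj : D.Obj → D'.Obj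
  iso : ∀ {A B}, D.Iso A B → D'.Iso (obj A) (obj B)
  bord : ∀ {A B}, D.Bord A B → D'.Bord (obj A) (obj B)
  unitIso : D'.Iso D'.unit (obj D.unit)
  sumIso : ∀ A B, D'.Iso (D'.sum (obj A) (obj B)) (obj (D.sum A B))
  glue : ∀ {A B C} {M : D.Bord A B} {M' : D.Bord B C} {N : D.Bord A C},
    D.IsGluing M M' N → D'.IsGluing (bord M) (bord M') (bord N)
  cylinder : ∀ {A B} {φ : D.Iso A B} {M : D.Bord A B},
    D.IsCylinder φ M → D'.IsCylinder (iso φ) (bord M)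
  diffeo : ∀ {A A' B B'} {φ : D.Iso A A'} {ψ : D.Iso B B'} {M : D.Bord A B} {N : D.Bord A' B'},
    D.IsDiffeo φ ψ M N → D'.IsDiffeo (iso φ) (iso ψ) (bord M) (bord N)
  -- Equality would be too strong: `X ×_G (M ⊔ N)` and `(X ×_G M) ⊔ (X ×_G N)` have different
  -- underlying types.
  sum_bord : ∀ {A B C E} (M : D.Bord A B) (N : D.Bord C E),
    D'.IsDiffeo (sumIso A C) (sumIso B E) (D'.sumBord (bord M) (bord N)) (bord (D.sumBord M N))
  iso_refl : ∀ A, iso (D.refl A) = D'.refl (obj A)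
  iso_trans : ∀ {A B C} (φ : D.Iso A B) (ψ : D.Iso B C),
    iso (D.trans φ ψ) = D'.trans (iso φ) (iso ψ)
  iso_sum : ∀ {A B C E} (φ : D.Iso A B) (ψ : D.Iso C E),
    D'.trans (D'.sumIso (iso φ) (iso ψ)) (sumIso B E) =
      D'.trans (sumIso A C) (iso (D.sumIso φ ψ))
  associativity : ∀ A B C,
    D'.trans (D'.trans (D'.sumIso (sumIso A B) (D'.refl (obj C))) (sumIso (D.sum A B) C))
        (iso (D.sumAssoc A B C)) =
      D'.trans (D'.sumAssoc (obj A) (obj B) (obj C))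
        (D'.trans (D'.sumIso (D'.refl (obj A)) (sumIso B C)) (sumIso A (D.sum B C)))
  left_unitality : ∀ A,
    D'.emptySum (obj A) =
      D'.trans (D'.trans (D'.sumIso unitIso (D'.refl (obj A))) (sumIso D.unit A))
        (iso (D.emptySum A))
  right_unitality : ∀ A,
    D'.sumEmpty (obj A) =
      D'.trans (D'.trans (D'.sumIso (D'.refl (obj A)) unitIso) (sumIso A D.unit))
        (iso (D.sumEmpty A))
  braided : ∀ A B,
    D'.trans (sumIso A B) (iso (D.sumComm A B)) =
      D'.trans (D'.sumComm (obj A) (obj B)) (sumIso B A)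

/-- The coherence laws of a symmetric monoidal category hold for the structure diffeomorphisms
themselves. -/
structure IsCoherent (D : CobordismData.{v, w}) : Prop where
  sum_refl : ∀ A B, D.sumIso (D.refl A) (D.refl B) = D.refl (D.sum A B)
  trans_symm : ∀ {A B} (φ : D.Iso A B), D.trans φ (D.symm φ) = D.refl A
  symm_trans : ∀ {A B} (φ : D.Iso A B), D.trans (D.symm φ) φ = D.refl B
  pentagon : ∀ A B C E,
    D.trans (D.sumIso (D.sumAssoc A B C) (D.refl E))
        (D.trans (D.sumAssoc A (D.sum B C) E) (D.sumIso (D.refl A) (D.sumAssoc B C E))) =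
      D.trans (D.sumAssoc (D.sum A B) C E) (D.sumAssoc A B (D.sum C E))
  triangle : ∀ A B,
    D.trans (D.sumAssoc A D.unit B) (D.sumIso (D.refl A) (D.emptySum B)) =
      D.sumIso (D.sumEmpty A) (D.refl B)
  hexagon : ∀ A B C,
    D.trans (D.sumAssoc A B C) (D.trans (D.sumComm A (D.sum B C)) (D.sumAssoc B C A)) =
      D.trans (D.sumIso (D.sumComm A B) (D.refl C))
        (D.trans (D.sumAssoc B A C) (D.sumIso (D.refl B) (D.sumComm A C)))
  hexagon_reverse : ∀ A B C,
    D.trans (D.symm (D.sumAssoc A B C))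
        (D.trans (D.sumComm (D.sum A B) C) (D.symm (D.sumAssoc C A B))) =
      D.trans (D.sumIso (D.refl A) (D.sumComm B C))
        (D.trans (D.symm (D.sumAssoc A C B)) (D.sumIso (D.sumComm A C) (D.refl B)))
  comm_comm : ∀ A B, D.trans (D.sumComm A B) (D.sumComm B A) = D.refl (D.sum A B)

/-- Together with `isoHom_sumIso` and `isoHom_refl` this turns every coherence law between
diffeomorphisms into one between morphisms. -/
theorem isoHom_trans {D : CobordismData.{v, w}} {A B C : D.Obj} (φ : D.Iso A B) (ψ : D.Iso B C) :
    (isoHom (D.trans φ ψ)).hom = (isoHom φ).hom ≫ (isoHom ψ).hom :=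
  sound (.symm (.comp_iso φ ψ))

theorem isoHom_sumIso {D : CobordismData.{v, w}} {A B C E : D.Obj} (φ : D.Iso A B)
    (ψ : D.Iso C E) :
    (isoHom (D.sumIso φ ψ)).hom = (isoHom φ).hom ⊗ₘ (isoHom ψ).hom :=
  sound (.symm (.sum_iso φ ψ))

theorem isoHom_refl {D : CobordismData.{v, w}} (A : D.Obj) :
    (isoHom (D.refl A)).hom = 𝟙 (Cat.mk A) := rfl

theorem bordHom_comp_isoHom {D : CobordismData.{v, w}} {A A' B B' : D.Obj} {φ : D.Iso A A'}
    {ψ : D.Iso B B'} {M : D.Bord A B} {N : D.Bord A' B'} (h : D.IsDiffeo φ ψ M N) :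
    bordHom M ≫ (isoHom ψ).hom = (isoHom φ).hom ≫ bordHom N :=
  sound (.diffeo h)

theorem bordHom_sumBord {D : CobordismData.{v, w}} {A B C E : D.Obj} (M : D.Bord A B)
    (N : D.Bord C E) : bordHom (D.sumBord M N) = bordHom M ⊗ₘ bordHom N :=
  sound (.symm (.sum_bord M N))

/-! ### The symmetric monoidal functor induced by a map of cobordism data. -/

namespace Morphism

variable {D : CobordismData.{v, w}} {D' : CobordismData.{v', w'}} (F : Morphism D D')

/-- The image of an object, as an object of the cobordism category. -/
abbrev ob (A : D.Obj) : D'.Cat := ⟨F.obj A⟩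

/-- The comparison of units, as a morphism of cobordism categories. -/
def eps : 𝟙_ D'.Cat ≅ F.ob D.unit :=
  isoHom F.unitIso

/-- The comparison of disjoint unions, as a morphism of cobordism categories. -/
def mu (A B : D.Obj) : F.ob A ⊗ F.ob B ≅ F.ob (D.sum A B) :=
  isoHom (F.sumIso A B)

/-- The action on formal composites. -/
def wordMap : ∀ {A B : D.Obj}, D.Word A B → (F.ob A ⟶ F.ob B)
  | _, _, .iso φ => (isoHom (F.iso φ)).hom
  | _, _, .bord M => bordHom (F.bord M)
  | _, _, .comp f g => wordMap f ≫ wordMap g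
  -- The tensor product runs between disjoint unions of images, the required value between images of
  -- disjoint unions; conjugation by `μ` bridges the two and makes `μ` natural by construction.
  | _, _, .sum f g => (F.mu _ _).inv ≫ (wordMap f ⊗ₘ wordMap g) ≫ (F.mu _ _).hom

section

variable {A B C E : D.Obj}

theorem wordMap_comp (f : D.Word A B) (g : D.Word B C) :
    F.wordMap (.comp f g) = F.wordMap f ≫ F.wordMap g := rfl

theorem wordMap_sum (f : D.Word A B) (g : D.Word C E) :
    F.wordMap (.sum f g) =
      (F.mu _ _).inv ≫ (F.wordMap f ⊗ₘ F.wordMap g) ≫ (F.mu _ _).hom := rfl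

theorem wordMap_iso (φ : D.Iso A B) : F.wordMap (.iso φ) = (isoHom (F.iso φ)).hom := rfl

theorem wordMap_refl (A : D.Obj) : F.wordMap (.iso (D.refl A)) = 𝟙 _ := by
  rw [wordMap_iso, F.iso_refl, isoHom_refl]

theorem wordMap_trans (φ : D.Iso A B) (ψ : D.Iso B C) :
    F.wordMap (.comp (.iso φ) (.iso ψ)) = F.wordMap (.iso (D.trans φ ψ)) := by
  rw [wordMap_iso, F.iso_trans, isoHom_trans]; rfl

/-- This is `iso_sum`, the naturality of `μ` for diffeomorphisms. With `wordMap_trans` it collapses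
any word made of diffeomorphisms to a single one. -/
theorem wordMap_sumIso (φ : D.Iso A B) (ψ : D.Iso C E) :
    F.wordMap (.sum (.iso φ) (.iso ψ)) = F.wordMap (.iso (D.sumIso φ ψ)) := by
  have h := congrArg (fun φ => (isoHom φ).hom) (F.iso_sum φ ψ)
  simp only [isoHom_trans, isoHom_sumIso] at h
  rw [wordMap_sum, Iso.inv_comp_eq]
  exact h

/-- Obtained by passing from diffeomorphisms to their morphisms in the law of `F`. It serves twice:
as a monoidal functor axiom, and for the naturality relation of the associator. -/
theorem mu_associativity (A B C : D.Obj) :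
    ((F.mu A B).hom ▷ F.ob C) ≫ (F.mu (D.sum A B) C).hom ≫ F.wordMap (.iso (D.sumAssoc A B C)) =
      (α_ (F.ob A) (F.ob B) (F.ob C)).hom ≫ (F.ob A ◁ (F.mu B C).hom) ≫
        (F.mu A (D.sum B C)).hom := by
  have h := congrArg (fun φ => (isoHom φ).hom) (F.associativity A B C)
  simp only [isoHom_trans, isoHom_sumIso, isoHom_refl, Category.assoc] at h
  rw [← tensorHom_id, ← id_tensorHom]
  exact h

theorem mu_left_unitality (A : D.Obj) :
    (λ_ (F.ob A)).hom =
      (F.eps.hom ▷ F.ob A) ≫ (F.mu D.unit A).hom ≫ F.wordMap (.iso (D.emptySum A)) := by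
  have h := congrArg (fun φ => (isoHom φ).hom) (F.left_unitality A)
  simp only [isoHom_trans, isoHom_sumIso, isoHom_refl, Category.assoc] at h
  rw [← tensorHom_id]
  exact h

theorem mu_right_unitality (A : D.Obj) :
    (ρ_ (F.ob A)).hom =
      (F.ob A ◁ F.eps.hom) ≫ (F.mu A D.unit).hom ≫ F.wordMap (.iso (D.sumEmpty A)) := by
  have h := congrArg (fun φ => (isoHom φ).hom) (F.right_unitality A)
  simp only [isoHom_trans, isoHom_sumIso, isoHom_refl, Category.assoc] at h
  rw [← id_tensorHom]
  exact h

theorem mu_braided (A B : D.Obj) :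
    (F.mu A B).hom ≫ F.wordMap (.iso (D.sumComm A B)) =
      (β_ (F.ob A) (F.ob B)).hom ≫ (F.mu B A).hom := by
  have h := congrArg (fun φ => (isoHom φ).hom) (F.braided A B)
  simp only [isoHom_trans] at h
  exact h

theorem wordMap_assoc_naturality {A' B' C' : D.Obj} (f : D.Word A A') (g : D.Word B B')
    (h : D.Word C C') :
    F.wordMap (.comp (.sum (.sum f g) h) (.iso (D.sumAssoc A' B' C'))) =
      F.wordMap (.comp (.iso (D.sumAssoc A B C)) (.sum f (.sum g h))) := by
  -- Precomposing with the invertible `μ`s moves the source to the disjoint union of the images,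
  -- where the associator of the target category is available.
  rw [← cancel_epi (F.mu (D.sum A B) C).hom, ← cancel_epi ((F.mu A B).hom ▷ F.ob C)]
  simp only [wordMap_comp, wordMap_sum, Category.assoc, Iso.hom_inv_id_assoc]
  have h1 : ((F.mu A B).hom ▷ F.ob C) ≫
      (((F.mu A B).inv ≫ (F.wordMap f ⊗ₘ F.wordMap g) ≫ (F.mu A' B').hom) ⊗ₘ F.wordMap h) =
      ((F.wordMap f ⊗ₘ F.wordMap g) ⊗ₘ F.wordMap h) ≫ ((F.mu A' B').hom ▷ F.ob C') := by
    simp only [← tensorHom_id, tensorHom_comp_tensorHom, Iso.hom_inv_id_assoc, Category.id_comp,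
      Category.comp_id]
  have h2 : (F.ob A ◁ (F.mu B C).hom) ≫
      (F.wordMap f ⊗ₘ ((F.mu B C).inv ≫ (F.wordMap g ⊗ₘ F.wordMap h) ≫ (F.mu B' C').hom)) =
      (F.wordMap f ⊗ₘ (F.wordMap g ⊗ₘ F.wordMap h)) ≫ (F.ob A' ◁ (F.mu B' C').hom) := by
    simp only [← id_tensorHom, tensorHom_comp_tensorHom, Iso.hom_inv_id_assoc, Category.id_comp,
      Category.comp_id]
  rw [reassoc_of% h1, mu_associativity, reassoc_of% (F.mu_associativity A B C),
    Iso.hom_inv_id_assoc, reassoc_of% h2, associator_naturality_assoc]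

theorem wordMap_left_naturality (f : D.Word A B) :
    F.wordMap (.comp (.sum (.iso (D.refl D.unit)) f) (.iso (D.emptySum B))) =
      F.wordMap (.comp (.iso (D.emptySum A)) f) := by
  rw [← cancel_epi (F.mu D.unit A).hom, ← cancel_epi (F.eps.hom ▷ F.ob A)]
  have h := reassoc_of% (F.mu_left_unitality A)
  simp only [wordMap_comp, wordMap_sum, Category.assoc, Iso.hom_inv_id_assoc, wordMap_refl,
    id_tensorHom]
  -- The unit comparison and the image of `f` act on different factors, so they can be interchanged;
  -- what remains is the naturality of the left unitor in the target.
  rw [← h, ← whisker_exchange_assoc, ← mu_left_unitality, leftUnitor_naturality]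

theorem wordMap_right_naturality (f : D.Word A B) :
    F.wordMap (.comp (.sum f (.iso (D.refl D.unit))) (.iso (D.sumEmpty B))) =
      F.wordMap (.comp (.iso (D.sumEmpty A)) f) := by
  rw [← cancel_epi (F.mu A D.unit).hom, ← cancel_epi (F.ob A ◁ F.eps.hom)]
  have h := reassoc_of% (F.mu_right_unitality A)
  simp only [wordMap_comp, wordMap_sum, Category.assoc, Iso.hom_inv_id_assoc, wordMap_refl,
    tensorHom_id]
  rw [← h, whisker_exchange_assoc, ← mu_right_unitality, rightUnitor_naturality]

theorem wordMap_comm_naturality {A' B' : D.Obj} (f : D.Word A A') (g : D.Word B B') :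
    F.wordMap (.comp (.sum f g) (.iso (D.sumComm A' B'))) =
      F.wordMap (.comp (.iso (D.sumComm A B)) (.sum g f)) := by
  rw [← cancel_epi (F.mu A B).hom]
  simp only [wordMap_comp, wordMap_sum, Category.assoc, Iso.hom_inv_id_assoc]
  rw [mu_braided, reassoc_of% (F.mu_braided A B), Iso.hom_inv_id_assoc,
    BraidedCategory.braiding_naturality_assoc]

/-- The diffeomorphism in the field `sum_bord` restricts to `μ` on both ends, so the relation
`diffeo` in the target gives exactly the naturality square of `μ` for this pair of cobordisms. -/
theorem wordMap_sum_bord (M : D.Bord A B) (N : D.Bord C E) :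
    F.wordMap (.sum (.bord M) (.bord N)) = F.wordMap (.bord (D.sumBord M N)) := by
  rw [wordMap_sum, Iso.inv_comp_eq]
  change (bordHom (F.bord M) ⊗ₘ bordHom (F.bord N)) ≫ _ = _
  rw [← bordHom_sumBord]
  exact bordHom_comp_isoHom (F.sum_bord M N)

theorem wordMap_congr_sum {f f' : D.Word A B} {g g' : D.Word C E}
    (h : F.wordMap f = F.wordMap f') (h' : F.wordMap g = F.wordMap g') :
    F.wordMap (.sum f g) = F.wordMap (.sum f' g') := by
  rw [wordMap_sum, wordMap_sum, h, h']

theorem wordMap_congr_comp {f f' : D.Word A B} {g g' : D.Word B C}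
    (h : F.wordMap f = F.wordMap f') (h' : F.wordMap g = F.wordMap g') :
    F.wordMap (.comp f g) = F.wordMap (.comp f' g') := by
  rw [wordMap_comp, wordMap_comp, h, h']

end

/-- The action on formal composites respects the relations. -/
theorem wordMap_eq (hD : D.IsCoherent) {A B : D.Obj} {f g : D.Word A B} (h : D.Rel f g) :
    F.wordMap f = F.wordMap g := by
  induction h with
  | glue h => exact sound (.glue (F.glue h))
  | cylinder h => exact sound (.cylinder (F.cylinder h))
  | diffeo h => exact bordHom_comp_isoHom (F.diffeo h)
  | sum_bord M N => exact F.wordMap_sum_bord M N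
  | sum_iso φ ψ => exact F.wordMap_sumIso φ ψ
  | comp_iso φ ψ => exact F.wordMap_trans φ ψ
  | iso_symm φ => rw [wordMap_trans, hD.trans_symm]
  | symm_iso φ => rw [wordMap_trans, hD.symm_trans]
  | refl f => rfl
  | symm _ ih => exact ih.symm
  | trans _ _ ih ih' => exact ih.trans ih'
  | congr_comp _ _ ih ih' => exact F.wordMap_congr_comp ih ih'
  | congr_sum _ _ ih ih' => exact F.wordMap_congr_sum ih ih'
  | id_comp f => rw [wordMap_comp, wordMap_refl, Category.id_comp]
  | comp_id f => rw [wordMap_comp, wordMap_refl, Category.comp_id]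
  | assoc f g h => simp only [wordMap_comp, Category.assoc]
  | sum_id A B => rw [wordMap_sumIso, hD.sum_refl]
  | sum_comp f g f' g' =>
    simp only [wordMap_comp, wordMap_sum, Category.assoc, Iso.hom_inv_id_assoc,
      ← tensorHom_comp_tensorHom]
  | assoc_naturality f g h => exact F.wordMap_assoc_naturality f g h
  | left_naturality f => exact F.wordMap_left_naturality f
  | right_naturality f => exact F.wordMap_right_naturality f
  | comm_naturality f g => exact F.wordMap_comm_naturality f g
  -- Both sides of this and the following relations are words in diffeomorphisms. Each side
  -- collapses to the image of one diffeomorphism of `D`, and the two diffeomorphisms agree by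
  -- coherence of `D`.
  | pentagon A B C E =>
    rw [F.wordMap_congr_comp (F.wordMap_sumIso _ _)
      ((F.wordMap_congr_comp rfl (F.wordMap_sumIso _ _)).trans (F.wordMap_trans _ _)),
      wordMap_trans, wordMap_trans, hD.pentagon]
  | triangle A B =>
    rw [F.wordMap_congr_comp rfl (F.wordMap_sumIso _ _), wordMap_trans, wordMap_sumIso,
      hD.triangle]
  | hexagon A B C =>
    rw [F.wordMap_congr_comp rfl (F.wordMap_trans _ _), wordMap_trans,
      F.wordMap_congr_comp (F.wordMap_sumIso _ _)
        ((F.wordMap_congr_comp rfl (F.wordMap_sumIso _ _)).trans (F.wordMap_trans _ _)),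
      wordMap_trans, hD.hexagon]
  | hexagon_reverse A B C =>
    rw [F.wordMap_congr_comp rfl (F.wordMap_trans _ _), wordMap_trans,
      F.wordMap_congr_comp (F.wordMap_sumIso _ _)
        ((F.wordMap_congr_comp rfl (F.wordMap_sumIso _ _)).trans (F.wordMap_trans _ _)),
      wordMap_trans, hD.hexagon_reverse]
  | comm_comm A B => rw [wordMap_trans, hD.comm_comm]

variable (hD : D.IsCoherent)

/-- The functor given by a morphism of cobordism data. -/
def functor : D.Cat ⥤ D'.Cat where
  obj A := ⟨F.obj A.obj⟩
  map {A B} f := Quotient.lift (s := D.wordSetoid A.obj B.obj) F.wordMap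
    (fun _ _ h => F.wordMap_eq hD h) f
  map_id A := F.wordMap_refl A.obj
  map_comp := by rintro _ _ _ ⟨f⟩ ⟨g⟩; rfl

/-- The monoidal structure of the functor given by a morphism of cobordism data. -/
def functorCoreMonoidal : (F.functor hD).CoreMonoidal where
  εIso := F.eps
  μIso A B := F.mu A.obj B.obj
  μIso_hom_natural_left := by
    rintro A B ⟨f⟩ C
    change (F.wordMap f ▷ F.ob C.obj) ≫ _ = (F.mu A.obj C.obj).hom ≫
      F.wordMap (.sum f (.iso (D.refl C.obj)))
    -- The `μ` in front cancels the inverse `μ` built into the value on disjoint unions.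
    rw [wordMap_sum, wordMap_refl, tensorHom_id, Iso.hom_inv_id_assoc]
  μIso_hom_natural_right := by
    rintro A B C ⟨f⟩
    change (F.ob C.obj ◁ F.wordMap f) ≫ _ = (F.mu C.obj A.obj).hom ≫
      F.wordMap (.sum (.iso (D.refl C.obj)) f)
    rw [wordMap_sum, wordMap_refl, id_tensorHom, Iso.hom_inv_id_assoc]
  associativity A B C := F.mu_associativity A.obj B.obj C.obj
  left_unitality A := F.mu_left_unitality A.obj
  right_unitality A := F.mu_right_unitality A.obj

/-- A morphism of cobordism data gives a symmetric monoidal functor. -/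
@[reducible] def functorBraided : (F.functor hD).Braided where
  toMonoidal := (F.functorCoreMonoidal hD).toMonoidal
  braided A B := F.mu_braided A.obj B.obj

end Morphism

end CobordismData

/-! ### Smoothness for manifold structures pulled back along a local homeomorphism. -/

section Pullback

variable {d : ℕ} {H : Type*} [TopologicalSpace H]
  {I : ModelWithCorners ℝ (EuclideanSpace ℝ (Fin d)) H} {M X : Type*} [TopologicalSpace M]
  [ChartedSpace H M] [TopologicalSpace X] {f : X → M} (hf : IsLocalHomeomorph f)

/-- The projection is smooth for the pulled back structure, with derivative the identity. -/
theorem pullback_proj :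
    letI := pullbackChartedSpace (H := H) hf
    ContMDiff I I ∞ f ∧ ∀ x, tderiv I I f x = ContinuousLinearMap.id ℝ _ := by
  let _ := pullbackChartedSpace (H := H) hf
  -- In the preferred charts at `x` and `f x` the map `f` is the identity near the base point, so
  -- smoothness and derivative can be copied from `id`.
  have key : ∀ x, (extChartAt I (f x) ∘ f ∘ (extChartAt I x).symm)
      =ᶠ[𝓝[Set.range I] (extChartAt I (f x) (f x))]
      (extChartAt I (f x) ∘ id ∘ (extChartAt I (f x)).symm) := by
    intro x
    filter_upwards [pullback_extChartAt_symm (I := I) hf x] with v hv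
    simp only [Function.comp_apply, hv, id]
  have key0 : ∀ x, (extChartAt I (f x) ∘ f ∘ (extChartAt I x).symm) (extChartAt I (f x) (f x)) =
      (extChartAt I (f x) ∘ id ∘ (extChartAt I (f x)).symm) (extChartAt I (f x) (f x)) := by
    intro x
    have := extChartAt_to_inv (I := I) x
    rw [pullback_extChartAt] at this
    simp only [Function.comp_apply, this, extChartAt_to_inv, id]
  have hs : ContMDiff I I ∞ f := by
    intro x
    rw [contMDiffAt_iff]
    refine ⟨hf.continuous.continuousAt, ?_⟩
    rw [pullback_extChartAt]
    exact (contMDiffAt_iff.1 (contMDiff_id (f x))).2.congr_of_eventuallyEq (key x) (key0 x)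
  refine ⟨hs, fun x => ?_⟩
  refine Eq.trans ?_ (mfderiv_id (I := I) (x := f x))
  unfold tderiv
  rw [(hs.mdifferentiable (by simp) x).mfderiv, mdifferentiableAt_id.mfderiv]
  unfold writtenInExtChartAt
  rw [pullback_extChartAt]
  exact (key x).fderivWithin_eq (key0 x)

/-- A continuous map to the covering space is smooth if its composite with the projection is. -/
theorem pullback_contMDiff {E' H' W : Type*} [NormedAddCommGroup E'] [NormedSpace ℝ E']
    [TopologicalSpace H'] {J : ModelWithCorners ℝ E' H'} [TopologicalSpace W] [ChartedSpace H' W]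
    {h : W → X} (hh : Continuous h) (hs : ContMDiff J I ∞ (f ∘ h)) :
    letI := pullbackChartedSpace (H := H) hf
    ContMDiff J I ∞ h := by
  let _ := pullbackChartedSpace (H := H) hf
  intro w
  rw [contMDiffAt_iff]
  refine ⟨hh.continuousAt, ?_⟩
  -- The chart of `X` at `h w` is `f` followed by the chart of `M`, so the coordinate expressions of
  -- `h` and `f ∘ h` agree everywhere, not just locally.
  refine (contMDiffAt_iff.1 (hs w)).2.congr_of_eventuallyEq (.of_forall fun v => ?_) ?_ <;>
    simp only [Function.comp_apply, pullback_extChartAt]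

end Pullback

/-- Where `k` takes values in `M`, it is locally the inclusion of `M` after the retraction that
collapses `N` to a point `m`. Quantifying over `m` covers empty summands. The result reduces
smoothness into a disjoint union of coverings to maps into a single covering, to which the
projection criterion applies. -/
theorem contMDiff_of_sumElim_const {E E' H H' : Type*} [NormedAddCommGroup E] [NormedSpace ℝ E]
    [NormedAddCommGroup E'] [NormedSpace ℝ E'] [TopologicalSpace H] [TopologicalSpace H']
    {I : ModelWithCorners ℝ E H} {J : ModelWithCorners ℝ E' H'} {M N W : Type*}
    [TopologicalSpace M] [TopologicalSpace N] [TopologicalSpace W] [ChartedSpace H M]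
    [ChartedSpace H N] [ChartedSpace H' W] {k : W → M ⊕ N} (hk : Continuous k)
    (hl : ∀ m, ContMDiff J I ∞ (Sum.elim id (fun _ => m) ∘ k))
    (hr : ∀ m, ContMDiff J I ∞ (Sum.elim (fun _ => m) id ∘ k)) : ContMDiff J I ∞ k := by
  intro w
  rcases hw : k w with m | m
  · refine ((ContMDiff.inl (M' := N)).comp (hl m) w).congr_of_eventuallyEq ?_
    have := hk.continuousAt.preimage_mem_nhds (isOpen_range_inl.mem_nhds ⟨m, hw.symm⟩)
    filter_upwards [this] with v ⟨m', hm'⟩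
    simp only [Function.comp_apply, ← hm', Sum.elim_inl, id]
  · refine ((ContMDiff.inr (M := M)).comp (hr m) w).congr_of_eventuallyEq ?_
    have := hk.continuousAt.preimage_mem_nhds (isOpen_range_inr.mem_nhds ⟨m, hw.symm⟩)
    filter_upwards [this] with v ⟨m', hm'⟩
    simp only [Function.comp_apply, ← hm', Sum.elim_inr, id]

/-! ### Smooth and oriented maps between associated coverings. -/

namespace PrincipalBundle

section

variable {G : Type w} [Group G] {M N : Type u} [TopologicalSpace M] [TopologicalSpace N]
  {P : PrincipalBundle G M} {Q : PrincipalBundle G N}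

theorem IsMap.inl : IsMap P (P.sum Q) Sum.inl Sum.inl :=
  ⟨continuous_inl, fun _ _ => rfl, fun _ => rfl⟩

theorem IsMap.inr : IsMap Q (P.sum Q) Sum.inr Sum.inr :=
  ⟨continuous_inr, fun _ _ => rfl, fun _ => rfl⟩

theorem IsMap.symm {f : M → N} {f' : N → M} {F : P.total ≃ₜ Q.total} (h : IsMap P Q f F)
    (hf : Function.LeftInverse f' f) : IsMap Q P f' F.symm where
  continuous := F.symm.continuous
  smul g q := by
    obtain ⟨p, rfl⟩ := F.surjective q
    rw [← h.smul, F.symm_apply_apply, F.symm_apply_apply]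
  proj q := by
    obtain ⟨p, rfl⟩ := F.surjective q
    rw [h.proj, F.symm_apply_apply, hf]

end

variable {G : Type w} [Group G] {X : Type u} [TopologicalSpace X] [DiscreteTopology X]
  [MulAction G X] {M N : Type u} [TopologicalSpace M] [TopologicalSpace N]

theorem assocProj_comp_assocMap {P : PrincipalBundle G M} {Q : PrincipalBundle G N} {f : M → N}
    {F : P.total → Q.total} (h : IsMap P Q f F) :
    Q.assocProj ∘ (assocMap h : P.Assoc X → Q.Assoc X) = f ∘ P.assocProj :=
  funext (assocProj_assocMap h)

section

variable {d : ℕ} {H : Type*} [TopologicalSpace H]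
  {I : ModelWithCorners ℝ (EuclideanSpace ℝ (Fin d)) H} [ChartedSpace H M] [ChartedSpace H N]

/-- The structure carried by `assocManifold` and `assocCobordism` alike, so each result below serves
for objects and for cobordisms. -/
noncomputable instance (P : PrincipalBundle G M) : ChartedSpace H (P.Assoc X) :=
  pullbackChartedSpace P.assocProj_isLocalHomeomorph

variable (P : PrincipalBundle G M) (Q : PrincipalBundle G N)

theorem contMDiff_assocProj : ContMDiff I I ∞ (P.assocProj : P.Assoc X → M) :=
  (pullback_proj P.assocProj_isLocalHomeomorph).1

theorem tderiv_assocProj (z : P.Assoc X) :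
    tderiv I I (P.assocProj : P.Assoc X → M) z = ContinuousLinearMap.id ℝ _ :=
  (pullback_proj P.assocProj_isLocalHomeomorph).2 z

theorem isOrientedMap_assocProj (o : M → Orientation ℝ (EuclideanSpace ℝ (Fin d)) (Fin d)) :
    IsOrientedMap I (o ∘ P.assocProj) o (P.assocProj : P.Assoc X → M) where
  smooth := P.contMDiff_assocProj
  orient z := by rw [tderiv_assocProj]; exact .id _

variable {P}

theorem contMDiff_of_assocProj_comp {E' H' W : Type*} [NormedAddCommGroup E'] [NormedSpace ℝ E']
    [TopologicalSpace H'] {J : ModelWithCorners ℝ E' H'} [TopologicalSpace W] [ChartedSpace H' W]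
    {h : W → P.Assoc X} (hh : Continuous h) (hs : ContMDiff J I ∞ (P.assocProj ∘ h)) :
    ContMDiff J I ∞ h :=
  pullback_contMDiff P.assocProj_isLocalHomeomorph hh hs

/-- The projection has identity derivative, so `h` and its composite with the projection have the
same derivative, and the target orientation is pulled back. -/
theorem isOrientedMap_of_assocProj_comp {W : Type*} [TopologicalSpace W] [ChartedSpace H W]
    {o : W → Orientation ℝ (EuclideanSpace ℝ (Fin d)) (Fin d)}
    {o' : M → Orientation ℝ (EuclideanSpace ℝ (Fin d)) (Fin d)}
    {h : W → P.Assoc X} (hh : Continuous h) (hs : IsOrientedMap I o o' (P.assocProj ∘ h)) :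
    IsOrientedMap I o (o' ∘ P.assocProj) h where
  smooth := contMDiff_of_assocProj_comp hh hs.smooth
  orient w := by
    have := hs.orient w
    rwa [tderiv_comp P.contMDiff_assocProj (contMDiff_of_assocProj_comp hh hs.smooth),
      tderiv_assocProj, ContinuousLinearMap.id_comp] at this

variable {Q} {f : M → N} {F : P.total → Q.total}

theorem contMDiff_assocMap (h : IsMap P Q f F) (hf : ContMDiff I I ∞ f) :
    ContMDiff I I ∞ (assocMap h : P.Assoc X → Q.Assoc X) := by
  refine contMDiff_of_assocProj_comp (continuous_assocMap h) ?_
  rw [assocProj_comp_assocMap]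
  exact hf.comp P.contMDiff_assocProj

theorem isOrientedMap_assocMap (h : IsMap P Q f F)
    {o : M → Orientation ℝ (EuclideanSpace ℝ (Fin d)) (Fin d)}
    {o' : N → Orientation ℝ (EuclideanSpace ℝ (Fin d)) (Fin d)} (hf : IsOrientedMap I o o' f) :
    IsOrientedMap I (o ∘ P.assocProj) (o' ∘ Q.assocProj)
      (assocMap h : P.Assoc X → Q.Assoc X) := by
  refine isOrientedMap_of_assocProj_comp (continuous_assocMap h) ?_
  rw [assocProj_comp_assocMap]
  exact hf.comp (P.isOrientedMap_assocProj o)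

variable (X) in
/-- The diffeomorphism of associated bundles induced by an isomorphism of bundles. -/
noncomputable def assocDiffeomorph {f : M ≃ₘ^∞⟮I, I⟯ N} {F : P.total ≃ₜ Q.total}
    (h : IsMap P Q f F) : P.Assoc X ≃ₘ^∞⟮I, I⟯ Q.Assoc X where
  toFun := assocMap h
  invFun := assocMap (h.symm f.symm_apply_apply)
  left_inv z := by
    obtain ⟨x, p, rfl⟩ := P.cls_surj z
    exact congrArg (P.cls x) (F.symm_apply_apply p)
  right_inv z := by
    obtain ⟨x, p, rfl⟩ := Q.cls_surj z
    exact congrArg (Q.cls x) (F.apply_symm_apply p)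
  contMDiff_toFun := contMDiff_assocMap h f.contMDiff
  contMDiff_invFun := contMDiff_assocMap (h.symm f.symm_apply_apply) f.symm.contMDiff

variable (P Q)

/-- The evident map `(X ×_G P) ⊔ (X ×_G Q) → X ×_G (P ⊔ Q)`. -/
def sumAssoc : P.Assoc X ⊕ Q.Assoc X → (P.sum Q).Assoc X :=
  Sum.elim (assocMap .inl) (assocMap .inr)

/-- The evident map `X ×_G (P ⊔ Q) → (X ×_G P) ⊔ (X ×_G Q)`. -/
def assocSum : (P.sum Q).Assoc X → P.Assoc X ⊕ Q.Assoc X :=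
  Quotient.lift (fun xp => Sum.map (P.cls xp.1) (Q.cls xp.1) xp.2) (by
    rintro _ ⟨x, p | p⟩ ⟨g, rfl⟩
    · exact congrArg Sum.inl (P.cls_eq_iff.2 ⟨g, rfl, rfl⟩)
    · exact congrArg Sum.inr (Q.cls_eq_iff.2 ⟨g, rfl, rfl⟩))

/-- As `X` is discrete, continuity on `X × (P ⊔ Q)` can be tested for one `x` at a time. -/
theorem continuous_assocSum : Continuous (assocSum P Q : (P.sum Q).Assoc X → _) := by
  refine Continuous.quotient_lift (continuous_prod_of_discrete_left.2 fun x => ?_) _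
  exact (P.continuous_cls.comp (.prodMk_right x)).sumMap (Q.continuous_cls.comp (.prodMk_right x))

theorem sumMap_assocProj_assocSum (z : (P.sum Q).Assoc X) :
    Sum.map P.assocProj Q.assocProj (assocSum P Q z) = (P.sum Q).assocProj z := by
  obtain ⟨x, p | p, rfl⟩ := cls_surj _ z <;> rfl

theorem contMDiff_assocSum : ContMDiff I I ∞ (assocSum P Q : (P.sum Q).Assoc X → _) := by
  refine contMDiff_of_sumElim_const (continuous_assocSum P Q) (fun z => ?_) fun z => ?_
  · refine contMDiff_of_assocProj_comp
      ((continuous_id.sumElim continuous_const).comp (continuous_assocSum P Q)) ?_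
    -- Collapsing the second summand commutes with the projections, so the composite to be tested is
    -- a smooth map of the bases after the projection of `X ×_G (P ⊔ Q)`.
    have h : P.assocProj ∘ Sum.elim id (fun _ => z) ∘ assocSum P Q =
        Sum.elim id (fun _ => P.assocProj z) ∘ (P.sum Q).assocProj := by
      funext e
      simp only [Function.comp_apply, ← sumMap_assocProj_assocSum]
      rcases assocSum P Q e with a | a <;> rfl
    rw [h]
    exact (contMDiff_id.sumElim contMDiff_const).comp (contMDiff_assocProj (P.sum Q))
  · refine contMDiff_of_assocProj_comp
      ((continuous_const.sumElim continuous_id).comp (continuous_assocSum P Q)) ?_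
    have h : Q.assocProj ∘ Sum.elim (fun _ => z) id ∘ assocSum P Q =
        Sum.elim (fun _ => Q.assocProj z) id ∘ (P.sum Q).assocProj := by
      funext e
      simp only [Function.comp_apply, ← sumMap_assocProj_assocSum]
      rcases assocSum P Q e with a | a <;> rfl
    rw [h]
    exact (contMDiff_const.sumElim contMDiff_id).comp (contMDiff_assocProj (P.sum Q))

variable (X I) in
/-- The evident diffeomorphism `(X ×_G P) ⊔ (X ×_G Q) ≅ X ×_G (P ⊔ Q)`. -/
noncomputable def sumAssocDiffeomorph : (P.Assoc X ⊕ Q.Assoc X) ≃ₘ^∞⟮I, I⟯ (P.sum Q).Assoc X where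
  toFun := sumAssoc P Q
  invFun := assocSum P Q
  left_inv := by
    rintro (z | z)
    · obtain ⟨x, p, rfl⟩ := P.cls_surj z
      rfl
    · obtain ⟨x, p, rfl⟩ := Q.cls_surj z
      rfl
  right_inv z := by obtain ⟨x, p | p, rfl⟩ := cls_surj _ z <;> rfl
  contMDiff_toFun := (contMDiff_assocMap _ .inl).sumElim (contMDiff_assocMap _ .inr)
  contMDiff_invFun := contMDiff_assocSum P Q

/-- On each summand the map is induced by the inclusion of that summand, which preserves
orientations. -/
theorem isOrientedMap_sumAssoc {o : M → Orientation ℝ (EuclideanSpace ℝ (Fin d)) (Fin d)}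
    {o' : N → Orientation ℝ (EuclideanSpace ℝ (Fin d)) (Fin d)} :
    IsOrientedMap I (Sum.elim (o ∘ P.assocProj) (o' ∘ Q.assocProj))
      (Sum.elim o o' ∘ (P.sum Q).assocProj) (sumAssocDiffeomorph X I P Q) :=
  .of_sum (isOrientedMap_assocMap .inl .inl) (isOrientedMap_assocMap .inr .inr)

end

/-- Openness matters: a product of open quotient maps is again a quotient map, so continuity on `(X
×_G P) × [0, 1]` can be tested on representatives. -/
theorem isOpenQuotientMap_cls (P : PrincipalBundle G M) :
    IsOpenQuotientMap fun z : X × P.total => P.cls z.1 z.2 :=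
  ⟨Quotient.mk_surjective, P.continuous_cls, P.isOpenMap_cls⟩

/-! ### Coverings of cylinders. -/

section Cylinder

variable {d : ℕ} [ChartedSpace (EuclideanSpace ℝ (Fin d)) M]
  [ChartedSpace (EuclideanHalfSpace (d + 1)) N]
  {P : PrincipalBundle G M} {Q : PrincipalBundle G N}
  {h : (M × Set.Icc (0 : ℝ) 1) ≃ₘ^∞⟮(𝓡 d).prod (𝓡∂ 1), 𝓡∂ (d + 1)⟯ N}
  {F : P.total × Set.Icc (0 : ℝ) 1 ≃ₜ Q.total}

/-- Slicing at `t` presents the map of a cylinder as a family of ordinary bundle maps, so `assocMap`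
applies to each slice. -/
theorem isMap_cylinder (hF : ∀ (g : G) p t, F (g • p, t) = g • F (p, t))
    (hp : ∀ p t, Q.proj (F (p, t)) = h (P.proj p, t)) (t : Set.Icc (0 : ℝ) 1) :
    IsMap P Q (fun m => h (m, t)) (fun p => F (p, t)) :=
  ⟨F.continuous.comp (.prodMk_left t), fun g p => hF g p t, fun p => hp p t⟩

/-- The inverse of the trivialization followed by the collapse of the cylinder onto `P`; it gives
the first component of the inverse on coverings. -/
theorem isMap_cylinder_symm (hF : ∀ (g : G) p t, F (g • p, t) = g • F (p, t))
    (hp : ∀ p t, Q.proj (F (p, t)) = h (P.proj p, t)) :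
    IsMap Q P (fun m => (h.symm m).1) (fun p => (F.symm p).1) where
  continuous := continuous_fst.comp F.symm.continuous
  smul g q := by
    obtain ⟨⟨p, t⟩, rfl⟩ := F.surjective q
    rw [← hF, F.symm_apply_apply, F.symm_apply_apply]
  proj q := by
    obtain ⟨⟨p, t⟩, rfl⟩ := F.surjective q
    rw [hp, F.symm_apply_apply, h.symm_apply_apply]

variable (X) in
/-- The diffeomorphism of associated bundles induced by an isomorphism of a bundle with a
cylinder. -/
noncomputable def assocCylinder (hF : ∀ (g : G) p t, F (g • p, t) = g • F (p, t))
    (hp : ∀ p t, Q.proj (F (p, t)) = h (P.proj p, t)) :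
    (P.Assoc X × Set.Icc (0 : ℝ) 1) ≃ₘ^∞⟮(𝓡 d).prod (𝓡∂ 1), 𝓡∂ (d + 1)⟯ Q.Assoc X where
  toFun z := assocMap (isMap_cylinder hF hp z.2) z.1
  -- Since `F` lies over `h`, the parameter `t` can be read off in the base. This makes it well
  -- defined on classes, and smooth as a composite with the projection.
  invFun z := (assocMap (isMap_cylinder_symm hF hp) z, (h.symm (Q.assocProj z)).2)
  left_inv := by
    rintro ⟨z, t⟩
    obtain ⟨x, p, rfl⟩ := P.cls_surj z
    refine Prod.ext ?_ ?_
    · change P.cls x (F.symm (F (p, t))).1 = P.cls x p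
      rw [F.symm_apply_apply]
    · change (h.symm (Q.proj (F (p, t)))).2 = t
      rw [hp, h.symm_apply_apply]
  right_inv z := by
    obtain ⟨x, q, rfl⟩ := Q.cls_surj z
    obtain ⟨⟨p, t⟩, rfl⟩ := F.surjective q
    change Q.cls x (F ((F.symm (F (p, t))).1, (h.symm (Q.proj (F (p, t)))).2)) = _
    rw [hp, h.symm_apply_apply, F.symm_apply_apply]
  contMDiff_toFun := by
    refine contMDiff_of_assocProj_comp ?_ ?_
    -- Continuity is not a statement about single slices: it has to be joint in the class and in
    -- `t`, hence the quotient map on the product.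
    · have hq := ((isOpenQuotientMap_cls (X := X) P).prodMap
        (IsOpenQuotientMap.id (X := Set.Icc (0 : ℝ) 1))).isQuotientMap
      rw [hq.continuous_iff]
      exact Q.continuous_cls.comp (continuous_fst.fst.prodMk
        (F.continuous.comp (continuous_fst.snd.prodMk continuous_snd)))
    · have : (Q.assocProj ∘ fun z : P.Assoc X × Set.Icc (0 : ℝ) 1 =>
          assocMap (isMap_cylinder hF hp z.2) z.1) = h ∘ Prod.map P.assocProj id :=
        funext fun z => assocProj_assocMap _ _
      change ContMDiff _ _ _ (Q.assocProj ∘ fun z : P.Assoc X × Set.Icc (0 : ℝ) 1 =>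
        assocMap (isMap_cylinder hF hp z.2) z.1)
      rw [this]
      exact h.contMDiff.comp (P.contMDiff_assocProj.prodMap contMDiff_id)
  contMDiff_invFun := by
    refine ContMDiff.prodMk (contMDiff_of_assocProj_comp (continuous_assocMap _) ?_) ?_
    · rw [assocProj_comp_assocMap]
      exact (contMDiff_fst.comp h.symm.contMDiff).comp Q.contMDiff_assocProj
    · exact (contMDiff_snd.comp h.symm.contMDiff).comp Q.contMDiff_assocProj

end Cylinder

end PrincipalBundle

/-! ### Extensionality of diffeomorphisms and coherence of `G`-manifolds. -/

theorem OrientedDiffeo.ext {n : ℕ} {A B : ClosedManifold.{u} n} {φ ψ : OrientedDiffeo A B}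
    (h : ∀ a, φ.map a = ψ.map a) : φ = ψ := by
  obtain ⟨f, hf⟩ := φ
  obtain ⟨g, hg⟩ := ψ
  obtain rfl : f = g := Diffeomorph.ext h
  rfl

theorem GDiffeo.ext {G : Type w} [Group G] {n : ℕ} {P Q : GManifold.{u} G n} {φ ψ : GDiffeo P Q}
    (h : ∀ a, φ.base.map a = ψ.base.map a) (h' : ∀ p, φ.total p = ψ.total p) : φ = ψ := by
  obtain ⟨f, F, hf⟩ := φ
  obtain ⟨g, K, hg⟩ := ψ
  obtain rfl : f = g := OrientedDiffeo.ext h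
  obtain rfl : F = K := Homeomorph.ext h'
  rfl

/-- By extensionality each law is an identity between maps of the underlying sets. The structure
maps only rearrange summands, so on each summand it holds by computation, except that the unit
summand in the triangle is empty. -/
theorem isCoherent_gcobData (G : Type w) [Group G] (n : ℕ) :
    (gcobData.{u} G n).IsCoherent where
  sum_refl A B := GDiffeo.ext (by rintro (a | a) <;> rfl) (by rintro (a | a) <;> rfl)
  trans_symm φ := GDiffeo.ext (fun a => φ.base.map.symm_apply_apply a)
    (fun p => φ.total.symm_apply_apply p)
  symm_trans φ := GDiffeo.ext (fun a => φ.base.map.apply_symm_apply a)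
    (fun p => φ.total.apply_symm_apply p)
  pentagon A B C E := GDiffeo.ext (by rintro (((a | a) | a) | a) <;> rfl)
    (by rintro (((a | a) | a) | a) <;> rfl)
  triangle A B := GDiffeo.ext
    (by rintro ((a | a) | a) <;> first | rfl | exact isEmptyElim (α := PEmpty) a)
    (by rintro ((a | a) | a) <;> first | rfl | exact isEmptyElim (α := PEmpty) a)
  hexagon A B C := GDiffeo.ext (by rintro ((a | a) | a) <;> rfl) (by rintro ((a | a) | a) <;> rfl)
  hexagon_reverse A B C := GDiffeo.ext (by rintro (a | a | a) <;> rfl)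
    (by rintro (a | a | a) <;> rfl)
  comm_comm A B := GDiffeo.ext (by rintro (a | a) <;> rfl) (by rintro (a | a) <;> rfl)

/-! ### The cover functor. -/

section Cover

open PrincipalBundle

variable {G : Type w} [Group G] [Finite G] {n : ℕ} (X : Type u) [TopologicalSpace X]
  [DiscreteTopology X] [Finite X] [MulAction G X]

/-- The diffeomorphism of covers induced by an isomorphism of `G`-bundles. -/
noncomputable def assocDiffeo {P Q : GManifold.{u} G n} (φ : GDiffeo P Q) :
    OrientedDiffeo (assocManifold X P) (assocManifold X Q) where
  map := assocDiffeomorph X (I := 𝓡 n) (f := φ.base.map) φ.isMap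
  oriented := isOrientedMap_assocMap φ.isMap φ.base.oriented

/-- The evident diffeomorphism `(X ×_G P) ⊔ (X ×_G Q) ≅ X ×_G (P ⊔ Q)`. -/
noncomputable def assocSumDiffeo (P Q : GManifold.{u} G n) :
    OrientedDiffeo ((assocManifold X P).sum (assocManifold X Q)) (assocManifold X (P.sum Q)) where
  map := sumAssocDiffeomorph X (𝓡 n) P.bundle Q.bundle
  oriented := isOrientedMap_sumAssoc P.bundle Q.bundle

instance : IsEmpty (assocManifold X (GManifold.empty.{u} G n)).carrier :=
  ⟨fun z => isEmptyElim (α := PEmpty) ((GManifold.empty.{u} G n).bundle.assocProj (X := X) z)⟩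

/-- The evident diffeomorphism `∅ ≅ X ×_G ∅`. -/
noncomputable def assocEmptyDiffeo :
    OrientedDiffeo (.empty n) (assocManifold X (GManifold.empty.{u} G n)) where
  map :=
    { toEquiv := Equiv.equivOfIsEmpty _ _
      contMDiff_toFun := fun x => isEmptyElim x
      contMDiff_invFun := fun x => isEmptyElim x }
  oriented := ⟨fun x => isEmptyElim x, fun x => isEmptyElim x⟩

variable {X}

/-- Images of induced maps are full preimages, so covering the base and meeting only in the seam
both lift from the bases to the coverings. -/
theorem assocCobordism_isGluing {P Q R : GManifold.{u} G n} {M : GCobordism P Q}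
    {M' : GCobordism Q R} {N : GCobordism P R} (h : GCobordism.IsGluing M M' N) :
    ∃ j j', Cobordism.IsGluingAlong (assocCobordism X M) (assocCobordism X M')
      (assocCobordism X N) j j' := by
  obtain ⟨j, j', J, J', hj, hJ, hJ', hs, hi, ho⟩ := h
  have seam (z : Q.bundle.Assoc X) :
      assocMap hJ (assocMap M.out_isMap z) = assocMap hJ' (assocMap M'.inc_isMap z) := by
    obtain ⟨x, q, rfl⟩ := Q.bundle.cls_surj z
    exact congrArg (N.bundle.cls x) (hs q)
  refine ⟨assocMap hJ, assocMap hJ', isOrientedMap_assocMap hJ hj.oriented,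
    isOrientedMap_assocMap hJ' hj.oriented', assocMap_injective hJ hj.injective,
    assocMap_injective hJ' hj.injective', ?_, seam, ?_, ?_, ?_⟩
  · change Set.range (assocMap hJ : _ → N.bundle.Assoc X) ∪ Set.range (assocMap hJ') = Set.univ
    rw [range_assocMap hJ, range_assocMap hJ', ← Set.preimage_union, hj.cover, Set.preimage_univ]
  · intro (z : M.bundle.Assoc X) (z' : M'.bundle.Assoc X) hz
    have hp := congrArg N.bundle.assocProj hz
    rw [assocProj_assocMap, assocProj_assocMap] at hp
    -- The seam condition in the base only places the projection of `z` in the outgoing boundary.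
    -- That `z` comes from some `y` is `range_assocMap`, and injectivity over `j'` then forces `z'`
    -- to come from the same `y`.
    obtain ⟨b, hb, -⟩ := hj.inter _ _ hp
    obtain ⟨y, rfl⟩ : z ∈ Set.range (assocMap M.out_isMap) := by
      rw [range_assocMap]
      exact ⟨b, hb.symm⟩
    exact ⟨y, rfl, assocMap_injective hJ' hj.injective' (hz.symm.trans (seam y))⟩
  · intro (z : P.bundle.Assoc X)
    obtain ⟨x, p, rfl⟩ := P.bundle.cls_surj z
    exact congrArg (N.bundle.cls x) (hi p)
  · intro (z : R.bundle.Assoc X)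
    obtain ⟨x, p, rfl⟩ := R.bundle.cls_surj z
    exact congrArg (N.bundle.cls x) (ho p)

theorem assocCobordism_isCylinder {P Q : GManifold.{u} G n} {φ : GDiffeo P Q}
    {M : GCobordism P Q} (h : GCobordism.IsCylinder φ M) :
    ∃ h, Cobordism.IsCylinderVia (assocDiffeo X φ) (assocCobordism X M) h := by
  obtain ⟨h, F, -, hF, hp, hi, ho⟩ := h
  refine ⟨assocCylinder X hF hp, fun z => ?_, fun z => ?_⟩
  · obtain ⟨x, p, rfl⟩ := P.bundle.cls_surj z
    exact congrArg (M.bundle.cls x) (hi p)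
  · obtain ⟨x, p, rfl⟩ := P.bundle.cls_surj z
    exact congrArg (M.bundle.cls x) (ho p)

theorem assocCobordism_isDiffeo {P P' Q Q' : GManifold.{u} G n} {φ : GDiffeo P P'}
    {ψ : GDiffeo Q Q'} {M : GCobordism P Q} {N : GCobordism P' Q'}
    (h : GCobordism.IsDiffeo φ ψ M N) :
    ∃ h, Cobordism.IsDiffeoVia (assocDiffeo X φ) (assocDiffeo X ψ) (assocCobordism X M)
      (assocCobordism X N) h := by
  obtain ⟨h, F, hh, hF, hi, ho⟩ := h
  refine ⟨assocDiffeomorph X hF, isOrientedMap_assocMap hF hh.oriented, fun z => ?_, fun z => ?_⟩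
  · obtain ⟨x, p, rfl⟩ := P.bundle.cls_surj z
    exact congrArg (N.bundle.cls x) (hi p)
  · obtain ⟨x, p, rfl⟩ := Q.bundle.cls_surj z
    exact congrArg (N.bundle.cls x) (ho p)

/-- The evident diffeomorphism for the bundles over the cobordisms restricts on the boundary to
those for the bundles over the ends. -/
theorem assocCobordism_sum {P Q R S : GManifold.{u} G n} (M : GCobordism P Q)
    (N : GCobordism R S) :
    ∃ h, Cobordism.IsDiffeoVia (assocSumDiffeo X P R) (assocSumDiffeo X Q S)
      ((assocCobordism X M).sum (assocCobordism X N)) (assocCobordism X (M.sum N)) h := by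
  refine ⟨sumAssocDiffeomorph X _ M.bundle N.bundle, isOrientedMap_sumAssoc M.bundle N.bundle,
    ?_, ?_⟩
  · rintro (z | z)
    · obtain ⟨x, p, rfl⟩ := P.bundle.cls_surj z
      rfl
    · obtain ⟨x, p, rfl⟩ := R.bundle.cls_surj z
      rfl
  · rintro (z | z)
    · obtain ⟨x, p, rfl⟩ := Q.bundle.cls_surj z
      rfl
    · obtain ⟨x, p, rfl⟩ := S.bundle.cls_surj z
      rfl

/-- On classes `[x, p]` the induced maps compute, so functoriality in diffeomorphisms becomes
definitional. -/
theorem OrientedDiffeo.ext_assoc {P : GManifold.{u} G n} {B : ClosedManifold.{u} n}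
    {φ ψ : OrientedDiffeo (assocManifold X P) B}
    (h : ∀ x p, φ.map (P.bundle.cls x p) = ψ.map (P.bundle.cls x p)) : φ = ψ :=
  OrientedDiffeo.ext fun z => by
    obtain ⟨x, p, rfl⟩ := P.bundle.cls_surj z
    exact h x p

variable (X G n)

/-- The assignment `P ↦ X ×_G P` on objects, diffeomorphisms and cobordisms. -/
noncomputable def coverMorphism : (gcobData.{u} G n).Morphism (cobData.{u} n) where
  obj := assocManifold X
  iso := assocDiffeo X
  bord := assocCobordism X
  unitIso := assocEmptyDiffeo X
  sumIso := assocSumDiffeo X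
  glue := assocCobordism_isGluing
  cylinder := assocCobordism_isCylinder
  diffeo := assocCobordism_isDiffeo
  sum_bord := assocCobordism_sum
  iso_refl _ := OrientedDiffeo.ext_assoc fun _ _ => rfl
  iso_trans _ _ := OrientedDiffeo.ext_assoc fun _ _ => rfl
  iso_sum {A _ C _} φ ψ := OrientedDiffeo.ext <| by
    rintro (z | z)
    · obtain ⟨x, p, rfl⟩ := A.bundle.cls_surj z
      rfl
    · obtain ⟨x, p, rfl⟩ := C.bundle.cls_surj z
      rfl
  associativity A B C := OrientedDiffeo.ext <| by
    rintro ((z | z) | z)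
    · obtain ⟨x, p, rfl⟩ := A.bundle.cls_surj z
      rfl
    · obtain ⟨x, p, rfl⟩ := B.bundle.cls_surj z
      rfl
    · obtain ⟨x, p, rfl⟩ := C.bundle.cls_surj z
      rfl
  left_unitality A := OrientedDiffeo.ext <| by
    rintro (z | z)
    · exact isEmptyElim (α := PEmpty) z
    · obtain ⟨x, p, rfl⟩ := A.bundle.cls_surj z
      rfl
  right_unitality A := OrientedDiffeo.ext <| by
    rintro (z | z)
    · obtain ⟨x, p, rfl⟩ := A.bundle.cls_surj z
      rfl
    · exact isEmptyElim (α := PEmpty) z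
  braided A B := OrientedDiffeo.ext <| by
    rintro (z | z)
    · obtain ⟨x, p, rfl⟩ := A.bundle.cls_surj z
      rfl
    · obtain ⟨x, p, rfl⟩ := B.bundle.cls_surj z
      rfl

/-- The cover functor `P ↦ X ×_G P`. -/
noncomputable abbrev coverFunctor : GCob.{u} G n ⥤ Cob.{u} n :=
  (coverMorphism G n X).functor (isCoherent_gcobData G n)

noncomputable instance : (coverFunctor G n X).Braided :=
  (coverMorphism G n X).functorBraided (isCoherent_gcobData G n)

/-- The shape of the `tensor` condition of `IsCoverFunctor` once the object equations are `rfl` and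
the transports are identities. -/
theorem id_tensorHom_id_comp_comp_id {C : Type*} [Category C] [MonoidalCategory C] {A B E : C}
    (f : MonoidalCategoryStruct.tensorObj A B ⟶ E) :
    MonoidalCategoryStruct.tensorHom (𝟙 A) (𝟙 B) ≫ f ≫ 𝟙 E = f := by
  simp

theorem isCoverFunctor_coverFunctor : IsCoverFunctor X (coverFunctor G n X) where
  obj _ := rfl
  map_cobordism _ := ((Category.id_comp _).trans (Category.comp_id _)).symm
  map_diffeo φ := ⟨assocDiffeo X φ, fun _ _ => rfl,
    ((Category.id_comp _).trans (Category.comp_id _)).symm⟩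
  unit := ⟨assocEmptyDiffeo X, (Category.comp_id _).symm⟩
  tensor P Q := ⟨assocSumDiffeo X P Q, fun _ _ => rfl, fun _ _ => rfl,
    (id_tensorHom_id_comp_comp_id ((coverMorphism G n X).mu P Q).hom).symm⟩

end Cover

end TFT

/-! ### Composition with a field theory, where `n` stands for `d - 1`. -/

theorem mainTheorem6 (n : ℕ) (G : Type w) [Group G] [Finite G]
    (X : Type u) [MulAction G X] [Finite X] [TopologicalSpace X] [DiscreteTopology X]
    (k : Type v) [Field k] (Z : TFT.Cob.{u} n ⥤ ModuleCat.{v} k) (hZ : Z.Braided) :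
    ∃ (F : TFT.GCob.{u} G n ⥤ TFT.Cob.{u} n) (hF : F.Braided), TFT.IsCoverFunctor X F ∧
      ∃ W : (F ⋙ Z).Braided,
        W.toMonoidal.toLaxMonoidal.ε =
          hZ.toMonoidal.toLaxMonoidal.ε ≫ Z.map hF.toMonoidal.toLaxMonoidal.ε ∧
        ∀ P Q : TFT.GCob.{u} G n, W.toMonoidal.toLaxMonoidal.μ P Q =
          hZ.toMonoidal.toLaxMonoidal.μ (F.obj P) (F.obj Q) ≫
            Z.map (hF.toMonoidal.toLaxMonoidal.μ P Q) :=
  -- The composite of braided functors is braided, and the unit and tensor comparisons of this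
  -- instance are the required formulas by definition.
  ⟨TFT.coverFunctor G n X, inferInstance, TFT.isCoverFunctor_coverFunctor G n X, inferInstance,
    rfl, fun _ _ => rfl⟩
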